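/- Let $\mathcal V$ be a Gray monoid (a semi-strict monoidal bicategory): a strict 2-category with a strictly associative and unital tensor product $\otimes$ (often written as juxtaposition) with unit $\mathbb 1$, such that $A\otimes-$ and $-\otimes B$ are strict 2-functors and there are invertible interchangers $\Sigma_{f,g}\colon (f\otimes B')\circ(A\otimes g)\Rightarrow(A'\otimes g)\circ(f\otimes B)$, for $f\colon A\to A'$ and $g\colon B\to B'$, satisfying the usual axioms (naturality in $f$ and $g$, compatibility with identities and composition in each variable, and with $\otimes$). Assume that $\mathcal V$ is right closed: for every object $A$ there are given a pseudofunctor $[A,-]\colon\mathcal V\to\mathcal V$ and a pseudoadjunction $-\otimes A\dashv[A,-]$, that is, pseudonatural transformations $\eta\colon \mathrm{id}\Rightarrow[A,-\otimes A]$ and $\varepsilon\colon[A,-]\otimes A\Rightarrow\mathrm{id}$, and invertible modifications (triangulators) with components $$s_B\colon 1_{B\otimes A}\Rightarrow\varepsilon_{B\otimes A}\circ(\eta_B\otimes A),\qquad t_B\colon[A,\varepsilon_B]\circ\eta_{[A,B]}\Rightarrow 1_{[A,B]},$$ satisfying the two swallowtail equations: the composite $\eta_B\Rightarrow[A,\varepsilon_{BA}]\circ[A,\eta_BA]\circ\eta_B\Rightarrow[A,\varepsilon_{BA}]\circ\eta_{[A,BA]}\circ\eta_B\Rightarrow\eta_B$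 of $[A,s_B]$, the pseudonaturality cell of $\eta$ at $\eta_B$, and $t_{BA}$ is the identity, and the composite $\varepsilon_B\Rightarrow\varepsilon_B\circ\varepsilon_{[A,B]A}\circ(\eta_{[A,B]}A)\Rightarrow\varepsilon_B\circ([A,\varepsilon_B]A)\circ(\eta_{[A,B]}A)\Rightarrow\varepsilon_B$ of $s_{[A,B]}$, the pseudonaturality cell of $\varepsilon$ at $\varepsilon_B$, and $t_BA$ is the identity. A $\mathcal V$-bicategory $\mathcal C$ consists of a collection of objects, hom-objects $\mathcal C(c,d)\in\mathcal V$, 1-cells $m\colon\mathcal C(d,e)\otimes\mathcal C(c,d)\to\mathcal C(c,e)$ and $u\colon\mathbb 1\to\mathcal C(c,c)$, and invertible 2-cells $\alpha\colon m\circ(m\otimes1)\Rightarrow m\circ(1\otimes m)$, $\lambda\colon m\circ(u\otimes1)\Rightarrow1$, $\rho\colon m\circ(1\otimes u)\Rightarrow1$, such that, as 2-cells $m\circ(m1)\circ(1u1)\Rightarrow m$ and $m\circ(m1)\circ(m11)\Rightarrow m\circ(1m)\circ(11m)$ respectively, $$(1\lambda)\cdot\alpha=\rho1,\qquad (1\alpha)\cdot\alpha\cdot(\alpha1)=\alpha\cdot\Sigma^{-1}\cdot\alpha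 ,$$ where the 2-cells are suitably whiskered and $\Sigma^{-1}\colon(1m)\circ(m11)\Rightarrow(m1)\circ(11m)$ is the inverse of the interchanger $\Sigma_{m,m}$. Then the following structure is a $\mathcal V$-bicategory. Its objects are the objects of $\mathcal V$ and its hom-objects are the $[a,b]$. Composition is $$m\colon[b,c][a,b]\xrightarrow{\ \eta\ }[a,[b,c][a,b]a]\xrightarrow{[a,1\varepsilon]}[a,[b,c]b]\xrightarrow{[a,\varepsilon]}[a,c],$$ and the unit is $u\colon\mathbb 1\xrightarrow{\ \eta\ }[a,\mathbb 1a]=[a,a]$. Let $e_m\colon\varepsilon\circ(m\otimes b)\Rightarrow\varepsilon\circ(1\otimes\varepsilon)$ (for $m\colon[c,d][b,c]\to[b,d]$) and $e_u\colon\varepsilon\circ(u\otimes a)\Rightarrow1_a$ be the invertible 2-cells obtained from the pseudonaturality of $\varepsilon$ followed by $s^{-1}$. Up to the functoriality constraints of the pseudofunctors $[a,-]$: * the associator $\alpha\colon m\circ(m1)\Rightarrow m\circ(1m)$ on $[c,d][b,c][a,b]$ slides $\eta$ along $m1$ by pseudonaturality, applies $[a,-]$ to the inverse interchanger of $m$ and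 $\varepsilon$ followed by $e_m$ (reaching $[a,\varepsilon\circ1\varepsilon\circ11\varepsilon]\circ\eta$), and then follows backwards the 2-cell that slides $\eta$ along $1m$ and applies $[a,-]$ to $1\otimes e_m$; * the left unitor $\lambda\colon m\circ(u1)\Rightarrow1$ slides $\eta$ along $u1$, applies $[a,-]$ to the inverse interchanger of $u$ and $\varepsilon$ followed by $e_u$ (reaching $[a,\varepsilon]\circ\eta$), and then applies $t$; * the right unitor $\rho\colon m\circ(1u)\Rightarrow1$ slides $\eta$ along $1u$, applies $[a,-]$ to $1\otimes e_u$ (reaching $[a,\varepsilon]\circ\eta$), and then applies $t$. -/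

import Mathlib

open CategoryTheory Bicategory

universe w v u w₁ v₁ u₁ w₂ v₂ u₂

/-! ### Pseudoadjunctions between pseudofunctors of bicategories -/

section Pseudoadjunction

variable {C : Type u₁} [Bicategory.{w₁, v₁} C] {D : Type u₂} [Bicategory.{w₂, v₂} D]

/-- Pseudonatural transformations `η : id ⟶ GF` and `ε : FG ⟶ id`: the 1- and 2-dimensional data
of a pseudoadjunction `F ⊣ G`. -/
structure UnitCounit (F : C ⥤ᵖ D) (G : D ⥤ᵖ C) where
  /-- The unit `η`. -/
  unit : Pseudofunctor.StrongTrans (Pseudofunctor.id C) (F.comp G)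
  /-- The counit `ε`. -/
  counit : Pseudofunctor.StrongTrans (G.comp F) (Pseudofunctor.id D)

namespace UnitCounit

variable {F : C ⥤ᵖ D} {G : D ⥤ᵖ C} (P : UnitCounit F G)

/-- The component `η_X`. -/
def unitApp (X : C) : X ⟶ G.obj (F.obj X) := P.unit.app X

/-- The component `ε_Y`. -/
def counitApp (Y : D) : F.obj (G.obj Y) ⟶ Y := P.counit.app Y

/-- The pseudonaturality constraint of `η` at a 1-cell. -/
def unitNat {X X' : C} (f : X ⟶ X') : f ≫ P.unitApp X' ≅ P.unitApp X ≫ G.map (F.map f) :=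
  P.unit.naturality f

/-- The pseudonaturality constraint of `ε` at a 1-cell. -/
def counitNat {Y Y' : D} (g : Y ⟶ Y') : F.map (G.map g) ≫ P.counitApp Y' ≅ P.counitApp Y ≫ g :=
  P.counit.naturality g

/-- The constraint at `f` of the pseudonatural transformation `F ⟶ FGF ⟶ F` with components
`F η_X ≫ ε_{F X}`. -/
def leftZigzagNat {X X' : C} (f : X ⟶ X') :
    F.map f ≫ F.map (P.unitApp X') ≫ P.counitApp (F.obj X') ≅
      (F.map (P.unitApp X) ≫ P.counitApp (F.obj X)) ≫ F.map f :=
  (α_ _ _ _).symm ≪≫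
  whiskerRightIso ((F.mapComp f (P.unitApp X')).symm ≪≫ F.map₂Iso (P.unitNat f) ≪≫
    F.mapComp (P.unitApp X) (G.map (F.map f))) (P.counitApp (F.obj X')) ≪≫
  α_ _ _ _ ≪≫
  whiskerLeftIso (F.map (P.unitApp X)) (P.counitNat (F.map f)) ≪≫
  (α_ _ _ _).symm

/-- The constraint at `g` of the pseudonatural transformation `G ⟶ GFG ⟶ G` with components
`η_{G Y} ≫ G ε_Y`. -/
def rightZigzagNat {Y Y' : D} (g : Y ⟶ Y') :
    G.map g ≫ P.unitApp (G.obj Y') ≫ G.map (P.counitApp Y') ≅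
      (P.unitApp (G.obj Y) ≫ G.map (P.counitApp Y)) ≫ G.map g :=
  (α_ _ _ _).symm ≪≫
  whiskerRightIso (P.unitNat (G.map g)) (G.map (P.counitApp Y')) ≪≫
  α_ _ _ _ ≪≫
  whiskerLeftIso (P.unitApp (G.obj Y)) ((G.mapComp (F.map (G.map g)) (P.counitApp Y')).symm ≪≫
    G.map₂Iso (P.counitNat g) ≪≫ G.mapComp (P.counitApp Y) g) ≪≫
  (α_ _ _ _).symm

end UnitCounit

/-- A (coherent) pseudoadjunction `F ⊣ G`: pseudonatural `η`, `ε`, and invertible modifications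
`s : id_F ⟶ εF ∘ Fη` and `t : Gε ∘ ηG ⟶ id_G` (the triangulators) satisfying the two swallowtail
equations. -/
structure Pseudoadjunction (F : C ⥤ᵖ D) (G : D ⥤ᵖ C) extends UnitCounit F G where
  /-- The components of the triangulator `s`. -/
  s (X : C) : 𝟙 (F.obj X) ≅ F.map (toUnitCounit.unitApp X) ≫ toUnitCounit.counitApp (F.obj X)
  /-- The components of the triangulator `t`. -/
  t (Y : D) : toUnitCounit.unitApp (G.obj Y) ≫ G.map (toUnitCounit.counitApp Y) ≅ 𝟙 (G.obj Y)
  /-- `s` is a modification. -/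
  s_modification {X X' : C} (f : X ⟶ X') :
    F.map f ◁ (s X').hom ≫ (toUnitCounit.leftZigzagNat f).hom =
      (ρ_ (F.map f)).hom ≫ (λ_ (F.map f)).inv ≫ (s X).hom ▷ F.map f
  /-- `t` is a modification. -/
  t_modification {Y Y' : D} (g : Y ⟶ Y') :
    G.map g ◁ (t Y').hom ≫ (ρ_ (G.map g)).hom ≫ (λ_ (G.map g)).inv =
      (toUnitCounit.rightZigzagNat g).hom ≫ (t Y).hom ▷ G.map g
  /-- The first swallowtail equation: the pasting of `Gs`, `η_η` and `tF` is the identity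
  of `η`. -/
  swallowtail_unit (X : C) :
    (ρ_ (toUnitCounit.unitApp X)).inv ≫
      toUnitCounit.unitApp X ◁ ((G.mapId (F.obj X)).inv ≫ G.map₂ (s X).hom ≫
        (G.mapComp (F.map (toUnitCounit.unitApp X)) (toUnitCounit.counitApp (F.obj X))).hom) ≫
      (α_ _ _ _).inv ≫
      (toUnitCounit.unitNat (toUnitCounit.unitApp X)).inv ▷ G.map (toUnitCounit.counitApp (F.obj X)) ≫
      (α_ _ _ _).hom ≫
      toUnitCounit.unitApp X ◁ (t (F.obj X)).hom ≫
      (ρ_ (toUnitCounit.unitApp X)).hom = 𝟙 (toUnitCounit.unitApp X)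
  /-- The second swallowtail equation: the pasting of `sG`, `ε_ε` and `Ft` is the identity
  of `ε`. -/
  swallowtail_counit (Y : D) :
    (λ_ (toUnitCounit.counitApp Y)).inv ≫
      (s (G.obj Y)).hom ▷ toUnitCounit.counitApp Y ≫
      (α_ _ _ _).hom ≫
      F.map (toUnitCounit.unitApp (G.obj Y)) ◁ (toUnitCounit.counitNat (toUnitCounit.counitApp Y)).inv ≫
      (α_ _ _ _).inv ≫
      ((F.mapComp (toUnitCounit.unitApp (G.obj Y)) (G.map (toUnitCounit.counitApp Y))).inv ≫
        F.map₂ (t Y).hom ≫ (F.mapId (G.obj Y)).hom) ▷ toUnitCounit.counitApp Y ≫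
      (λ_ (toUnitCounit.counitApp Y)).hom = 𝟙 (toUnitCounit.counitApp Y)

end Pseudoadjunction

/-! ### Gray monoids -/

/-- A Gray monoid (semi-strict monoidal bicategory): a monoid, for the Gray tensor product, in the
category of strict 2-categories and strict 2-functors. Explicitly, it is a strict 2-category with
a unit object, strict 2-functors `A ⊗ -` (`lMap`, `lMap₂`) and `- ⊗ B` (`rMap`, `rMap₂`) agreeing
on objects, and invertible interchangers `Σ_{f,g} : (f ⊗ B') ∘ (A ⊗ g) ⟶ (A' ⊗ g) ∘ (f ⊗ B)`,
such that the tensor product is strictly associative and unital. Strict equalities between cells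
whose boundaries are only propositionally equal are written with heterogeneous equality `≍`. -/
class GrayMonoid (V : Type u) [Bicategory.{w, v} V] : Type (max u v w)
    extends Bicategory.Strict V where
  /-- Tensor product of objects. -/
  tensorObj : V → V → V
  /-- The unit object. -/
  tensorUnit : V
  /-- `A ⊗ g`. -/
  lMap (A : V) {B B' : V} (g : B ⟶ B') : tensorObj A B ⟶ tensorObj A B'
  /-- `A ⊗ β`. -/
  lMap₂ (A : V) {B B' : V} {g g' : B ⟶ B'} (β : g ⟶ g') : lMap A g ⟶ lMap A g'
  /-- `f ⊗ B`. -/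
  rMap {A A' : V} (f : A ⟶ A') (B : V) : tensorObj A B ⟶ tensorObj A' B
  /-- `α ⊗ B`. -/
  rMap₂ {A A' : V} {f f' : A ⟶ A'} (α : f ⟶ f') (B : V) : rMap f B ⟶ rMap f' B
  -- `A ⊗ -` is a strict 2-functor
  lMap_id (A B : V) : lMap A (𝟙 B) = 𝟙 (tensorObj A B)
  lMap_comp (A : V) {B B' B'' : V} (g : B ⟶ B') (h : B' ⟶ B'') :
    lMap A (g ≫ h) = lMap A g ≫ lMap A h
  lMap₂_id (A : V) {B B' : V} (g : B ⟶ B') : lMap₂ A (𝟙 g) = 𝟙 (lMap A g)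
  lMap₂_comp (A : V) {B B' : V} {g g' g'' : B ⟶ B'} (β : g ⟶ g') (β' : g' ⟶ g'') :
    lMap₂ A (β ≫ β') = lMap₂ A β ≫ lMap₂ A β'
  lMap₂_whiskerLeft (A : V) {B B' B'' : V} (f : B ⟶ B') {g g' : B' ⟶ B''} (β : g ⟶ g') :
    lMap₂ A (f ◁ β) ≍ lMap A f ◁ lMap₂ A β
  lMap₂_whiskerRight (A : V) {B B' B'' : V} {f f' : B ⟶ B'} (β : f ⟶ f') (g : B' ⟶ B'') :
    lMap₂ A (β ▷ g) ≍ lMap₂ A β ▷ lMap A g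
  -- `- ⊗ B` is a strict 2-functor
  rMap_id (A B : V) : rMap (𝟙 A) B = 𝟙 (tensorObj A B)
  rMap_comp {A A' A'' : V} (f : A ⟶ A') (h : A' ⟶ A'') (B : V) :
    rMap (f ≫ h) B = rMap f B ≫ rMap h B
  rMap₂_id {A A' : V} (f : A ⟶ A') (B : V) : rMap₂ (𝟙 f) B = 𝟙 (rMap f B)
  rMap₂_comp {A A' : V} {f f' f'' : A ⟶ A'} (α : f ⟶ f') (α' : f' ⟶ f'') (B : V) :
    rMap₂ (α ≫ α') B = rMap₂ α B ≫ rMap₂ α' B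
  rMap₂_whiskerLeft {A A' A'' : V} (f : A ⟶ A') {g g' : A' ⟶ A''} (α : g ⟶ g') (B : V) :
    rMap₂ (f ◁ α) B ≍ rMap f B ◁ rMap₂ α B
  rMap₂_whiskerRight {A A' A'' : V} {f f' : A ⟶ A'} (α : f ⟶ f') (g : A' ⟶ A'') (B : V) :
    rMap₂ (α ▷ g) B ≍ rMap₂ α B ▷ rMap g B
  /-- The interchanger `Σ_{f,g}`. -/
  interchanger {A A' B B' : V} (f : A ⟶ A') (g : B ⟶ B') :
    lMap A g ≫ rMap f B' ≅ rMap f B ≫ lMap A' g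
  -- axioms for the interchanger
  interchanger_naturality {A A' B B' : V} {f f' : A ⟶ A'} {g g' : B ⟶ B'}
      (α : f ⟶ f') (β : g ⟶ g') :
    lMap₂ A β ▷ rMap f B' ≫ lMap A g' ◁ rMap₂ α B' ≫ (interchanger f' g').hom =
      (interchanger f g).hom ≫ rMap₂ α B ▷ lMap A' g ≫ rMap f' B ◁ lMap₂ A' β
  interchanger_id_left (A : V) {B B' : V} (g : B ⟶ B') :
    (interchanger (𝟙 A) g).hom ≍ 𝟙 (lMap A g)
  interchanger_id_right {A A' : V} (f : A ⟶ A') (B : V) :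
    (interchanger f (𝟙 B)).hom ≍ 𝟙 (rMap f B)
  interchanger_comp_left {A A' A'' B B' : V} (f : A ⟶ A') (f' : A' ⟶ A'') (g : B ⟶ B') :
    (interchanger (f ≫ f') g).hom ≍
      (α_ (lMap A g) (rMap f B') (rMap f' B')).inv ≫ (interchanger f g).hom ▷ rMap f' B' ≫
        (α_ _ _ _).hom ≫ rMap f B ◁ (interchanger f' g).hom ≫
        (α_ (rMap f B) (rMap f' B) (lMap A'' g)).inv
  interchanger_comp_right {A A' B B' B'' : V} (f : A ⟶ A') (g : B ⟶ B') (g' : B' ⟶ B'') :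
    (interchanger f (g ≫ g')).hom ≍
      (α_ (lMap A g) (lMap A g') (rMap f B'')).hom ≫ lMap A g ◁ (interchanger f g').hom ≫
        (α_ _ _ _).inv ≫ (interchanger f g).hom ▷ lMap A' g' ≫
        (α_ (rMap f B) (lMap A' g) (lMap A' g')).hom
  -- strict associativity
  tensor_assoc (A B C : V) : tensorObj (tensorObj A B) C = tensorObj A (tensorObj B C)
  rMap_rMap {A A' : V} (f : A ⟶ A') (B C : V) :
    rMap (rMap f B) C ≍ rMap f (tensorObj B C)
  rMap_lMap (A : V) {B B' : V} (f : B ⟶ B') (C : V) :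
    rMap (lMap A f) C ≍ lMap A (rMap f C)
  lMap_tensor (A B : V) {C C' : V} (f : C ⟶ C') :
    lMap (tensorObj A B) f ≍ lMap A (lMap B f)
  rMap₂_rMap₂ {A A' : V} {f f' : A ⟶ A'} (α : f ⟶ f') (B C : V) :
    rMap₂ (rMap₂ α B) C ≍ rMap₂ α (tensorObj B C)
  rMap₂_lMap₂ (A : V) {B B' : V} {f f' : B ⟶ B'} (α : f ⟶ f') (C : V) :
    rMap₂ (lMap₂ A α) C ≍ lMap₂ A (rMap₂ α C)
  lMap₂_tensor (A B : V) {C C' : V} {f f' : C ⟶ C'} (α : f ⟶ f') :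
    lMap₂ (tensorObj A B) α ≍ lMap₂ A (lMap₂ B α)
  lMap₂_interchanger (A : V) {B B' C C' : V} (f : B ⟶ B') (g : C ⟶ C') :
    lMap₂ A (interchanger f g).hom ≍ (interchanger (lMap A f) g).hom
  interchanger_rMap_lMap {A A' C C' : V} (f : A ⟶ A') (B : V) (g : C ⟶ C') :
    (interchanger (rMap f B) g).hom ≍ (interchanger f (lMap B g)).hom
  rMap₂_interchanger {A A' B B' : V} (f : A ⟶ A') (g : B ⟶ B') (C : V) :
    rMap₂ (interchanger f g).hom C ≍ (interchanger f (rMap g C)).hom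
  -- strict unitality
  unit_tensor (A : V) : tensorObj tensorUnit A = A
  tensor_unit (A : V) : tensorObj A tensorUnit = A
  lMap_unit {A B : V} (f : A ⟶ B) : lMap tensorUnit f ≍ f
  rMap_unit {A B : V} (f : A ⟶ B) : rMap f tensorUnit ≍ f
  lMap₂_unit {A B : V} {f g : A ⟶ B} (α : f ⟶ g) : lMap₂ tensorUnit α ≍ α
  rMap₂_unit {A B : V} {f g : A ⟶ B} (α : f ⟶ g) : rMap₂ α tensorUnit ≍ α

namespace GrayMonoid

variable {V : Type u} [Bicategory.{w, v} V] [GrayMonoid V]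

infixr:70 " ⊠ " => GrayMonoid.tensorObj

/-- The equality `(A ⊗ B) ⊗ C = A ⊗ (B ⊗ C)`, as an (identity) 1-cell. -/
abbrev asc (A B C : V) : (A ⊠ B) ⊠ C ⟶ A ⊠ (B ⊠ C) := eqToHom (tensor_assoc A B C)

/-- The equality `1 ⊗ A = A`, as an (identity) 1-cell. -/
abbrev lun (A : V) : tensorUnit ⊠ A ⟶ A := eqToHom (unit_tensor A)

/-- The equality `A ⊗ 1 = A`, as an (identity) 1-cell. -/
abbrev run (A : V) : A ⊠ tensorUnit ⟶ A := eqToHom (tensor_unit A)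

theorem rMap_rMap_eq {A A' : V} (f : A ⟶ A') (B C : V) :
    rMap (rMap f B) C =
      eqToHom (tensor_assoc A B C) ≫ rMap f (B ⊠ C) ≫ eqToHom (tensor_assoc A' B C).symm :=
  (conj_eqToHom_iff_heq' _ _ _ (tensor_assoc A' B C).symm).2 (rMap_rMap f B C)

theorem rMap_lMap_eq (A : V) {B B' : V} (f : B ⟶ B') (C : V) :
    rMap (lMap A f) C =
      eqToHom (tensor_assoc A B C) ≫ lMap A (rMap f C) ≫ eqToHom (tensor_assoc A B' C).symm :=
  (conj_eqToHom_iff_heq' _ _ _ (tensor_assoc A B' C).symm).2 (rMap_lMap A f C)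

theorem lMap_tensor_eq (A B : V) {C C' : V} (f : C ⟶ C') :
    lMap (A ⊠ B) f =
      eqToHom (tensor_assoc A B C) ≫ lMap A (lMap B f) ≫ eqToHom (tensor_assoc A B C').symm :=
  (conj_eqToHom_iff_heq' _ _ _ (tensor_assoc A B C').symm).2 (lMap_tensor A B f)

theorem lMap_unit_eq {A B : V} (f : A ⟶ B) :
    lMap tensorUnit f = eqToHom (unit_tensor A) ≫ f ≫ eqToHom (unit_tensor B).symm :=
  (conj_eqToHom_iff_heq' _ _ _ (unit_tensor B).symm).2 (lMap_unit f)

theorem rMap_eqToHom {A A' : V} (h : A = A') (B : V) :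
    rMap (eqToHom h) B = eqToHom (congrArg (· ⊠ B) h) := by
  cases h; exact rMap_id A B

theorem lMap_eqToHom (A : V) {B B' : V} (h : B = B') :
    lMap A (eqToHom h) = eqToHom (congrArg (A ⊠ ·) h) := by
  cases h; exact lMap_id A B

/-- `A ⊗ β` for an invertible 2-cell `β`. -/
@[simps]
def lMap₂Iso (A : V) {B B' : V} {g g' : B ⟶ B'} (β : g ≅ g') : lMap A g ≅ lMap A g' where
  hom := lMap₂ A β.hom
  inv := lMap₂ A β.inv
  hom_inv_id := by rw [← lMap₂_comp, β.hom_inv_id, lMap₂_id]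
  inv_hom_id := by rw [← lMap₂_comp, β.inv_hom_id, lMap₂_id]

variable (V) in
/-- The pseudofunctor (in fact strict 2-functor) `- ⊗ A`. -/
def tensorRight (A : V) : V ⥤ᵖ V :=
  (StrictPseudofunctor.mk'' (B := V) (C := V)
    { obj := fun X => X ⊠ A
      map := fun f => rMap f A
      map₂ := fun α => rMap₂ α A
      map₂_id := fun f => rMap₂_id f A
      map₂_comp := fun α β => rMap₂_comp α β A
      map_id := fun X => rMap_id X A
      map_comp := fun f g => rMap_comp f g A
      map₂_whisker_left := fun f _ g' α =>
        (conj_eqToHom_iff_heq' _ _ _ (rMap_comp f g' A).symm).2 (rMap₂_whiskerLeft f α A)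
      map₂_whisker_right := fun {_ _ _ _ f'} α g =>
        (conj_eqToHom_iff_heq' _ _ _ (rMap_comp f' g A).symm).2 (rMap₂_whiskerRight α g A) }).toPseudofunctor

/-- An equality between the indices of a family of 1-cells slides past the members of the family. -/
theorem eqToHom_family {ι : Type*} {x y : ι → V} (k : ∀ i, x i ⟶ y i) {i j : ι} (h : i = j) :
    eqToHom (congrArg x h) ≫ k j = k i ≫ eqToHom (congrArg y h) := by
  cases h; simp

end GrayMonoid

/-! ### Bicategories enriched in a Gray monoid -/

open GrayMonoid

/-- The data of a bicategory enriched in a Gray monoid `V`, with collection of objects `O`. -/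
structure EnrichedBicategoryData (V : Type u) [Bicategory.{w, v} V] [GrayMonoid V]
    (O : Type u₁) where
  /-- The hom-objects. -/
  hom : O → O → V
  /-- The composition 1-cells `m`. -/
  comp (c d e : O) : hom d e ⊠ hom c d ⟶ hom c e
  /-- The unit 1-cells `u`. -/
  unit (c : O) : (tensorUnit : V) ⟶ hom c c
  /-- The associator `α : m ∘ (m ⊗ 1) ⟶ m ∘ (1 ⊗ m)`. -/
  associator (c d e f : O) :
    rMap (comp d e f) (hom c d) ≫ comp c d f ≅
      asc (hom e f) (hom d e) (hom c d) ≫ lMap (hom e f) (comp c d e) ≫ comp c e f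
  /-- The left unitor `λ : m ∘ (u ⊗ 1) ⟶ 1`. -/
  leftUnitor (c d : O) : rMap (unit d) (hom c d) ≫ comp c d d ≅ lun (hom c d)
  /-- The right unitor `ρ : m ∘ (1 ⊗ u) ⟶ 1`. -/
  rightUnitor (c d : O) : lMap (hom c d) (unit c) ≫ comp c c d ≅ run (hom c d)

namespace EnrichedBicategoryData

variable {V : Type u} [Bicategory.{w, v} V] [GrayMonoid V] {O : Type u₁}
  (B : EnrichedBicategoryData V O)

/-- The 2-cell `(1λ) ∘ α : m ∘ (m ⊗ 1) ∘ (1 ⊗ u ⊗ 1) ⟶ m`. -/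
def unitPastingLeft (c d e : O) :
    rMap (lMap (B.hom d e) (B.unit d)) (B.hom c d) ≫ rMap (B.comp d d e) (B.hom c d) ≫
        B.comp c d e ⟶
      asc (B.hom d e) tensorUnit (B.hom c d) ≫ lMap (B.hom d e) (lun (B.hom c d)) ≫
        B.comp c d e :=
  rMap (lMap (B.hom d e) (B.unit d)) (B.hom c d) ◁ (B.associator c d d e).hom ≫
  eqToHom (by simp [rMap_lMap_eq, lMap_comp]) ≫
  asc (B.hom d e) tensorUnit (B.hom c d) ◁
    (lMap₂ (B.hom d e) (B.leftUnitor c d).hom ▷ B.comp c d e)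

/-- The 2-cell `ρ1 : m ∘ (m ⊗ 1) ∘ (1 ⊗ u ⊗ 1) ⟶ m`. -/
def unitPastingRight (c d e : O) :
    rMap (lMap (B.hom d e) (B.unit d)) (B.hom c d) ≫ rMap (B.comp d d e) (B.hom c d) ≫
        B.comp c d e ⟶
      rMap (run (B.hom d e)) (B.hom c d) ≫ B.comp c d e :=
  eqToHom (by simp [rMap_comp]) ≫
  rMap₂ (B.rightUnitor d e).hom (B.hom c d) ▷ B.comp c d e

/-- The 2-cell `(1α) ∘ α ∘ (α1) : m ∘ (m ⊗ 1) ∘ (m ⊗ 1 ⊗ 1) ⟶ m ∘ (1 ⊗ m) ∘ (1 ⊗ 1 ⊗ m)`. -/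
def assocPastingLeft (a b c d e : O) :
    rMap (rMap (B.comp c d e) (B.hom b c)) (B.hom a b) ≫ rMap (B.comp b c e) (B.hom a b) ≫
        B.comp a b e ⟶
      eqToHom (by simp [tensor_assoc]) ≫
        lMap (B.hom d e) (lMap (B.hom c d) (B.comp a b c)) ≫
        lMap (B.hom d e) (B.comp a c d) ≫ B.comp a d e :=
  eqToHom (by simp [rMap_comp]) ≫
  rMap₂ (B.associator b c d e).hom (B.hom a b) ▷ B.comp a b e ≫
  eqToHom (by simp [rMap_comp]) ≫
  (rMap (asc (B.hom d e) (B.hom c d) (B.hom b c)) (B.hom a b) ≫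
    rMap (lMap (B.hom d e) (B.comp b c d)) (B.hom a b)) ◁ (B.associator a b d e).hom ≫
  eqToHom (by simp [rMap_lMap_eq, rMap_eqToHom, lMap_comp]) ≫
  (eqToHom (by simp [tensor_assoc]) :
    ((B.hom d e ⊠ B.hom c d) ⊠ B.hom b c) ⊠ B.hom a b ⟶
      B.hom d e ⊠ ((B.hom c d ⊠ B.hom b c) ⊠ B.hom a b)) ◁
    (lMap₂ (B.hom d e) (B.associator a b c d).hom ▷ B.comp a d e) ≫
  eqToHom (by simp [lMap_comp, lMap_eqToHom])

/-- The 2-cell `α ∘ Σ ∘ α : m ∘ (m ⊗ 1) ∘ (m ⊗ 1 ⊗ 1) ⟶ m ∘ (1 ⊗ m) ∘ (1 ⊗ 1 ⊗ m)`, where the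
middle 2-cell is the interchange of `m ⊗ 1 ⊗ 1` and `1 ⊗ m`. -/
def assocPastingRight (a b c d e : O) :
    rMap (rMap (B.comp c d e) (B.hom b c)) (B.hom a b) ≫ rMap (B.comp b c e) (B.hom a b) ≫
        B.comp a b e ⟶
      eqToHom (by simp [tensor_assoc]) ≫
        lMap (B.hom d e) (lMap (B.hom c d) (B.comp a b c)) ≫
        lMap (B.hom d e) (B.comp a c d) ≫ B.comp a d e :=
  rMap (rMap (B.comp c d e) (B.hom b c)) (B.hom a b) ◁ (B.associator a b c e).hom ≫
  eqToHom (by simp [rMap_rMap_eq]) ≫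
  asc (B.hom d e ⊠ B.hom c d) (B.hom b c) (B.hom a b) ◁
    ((interchanger (B.comp c d e) (B.comp a b c)).inv ▷ B.comp a c e) ≫
  eqToHom (by simp) ≫
  (asc (B.hom d e ⊠ B.hom c d) (B.hom b c) (B.hom a b) ≫
    lMap (B.hom d e ⊠ B.hom c d) (B.comp a b c)) ◁ (B.associator a c d e).hom ≫
  eqToHom (by simp [lMap_tensor_eq])

end EnrichedBicategoryData

/-- A bicategory enriched in a Gray monoid `V` (a `V`-bicategory): data subject to the identity
coherence and the associativity coherence. The two 2-cells in the identity coherence have targets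
which are equal 1-cells, both being `m` up to the strict unit constraints. -/
structure EnrichedBicategory (V : Type u) [Bicategory.{w, v} V] [GrayMonoid V] (O : Type u₁)
    extends EnrichedBicategoryData V O where
  identity_coherence (c d e : O) :
    toEnrichedBicategoryData.unitPastingLeft c d e ≫
        eqToHom (by simp [rMap_eqToHom, lMap_eqToHom]) =
      toEnrichedBicategoryData.unitPastingRight c d e
  associativity_coherence (a b c d e : O) :
    toEnrichedBicategoryData.assocPastingLeft a b c d e =
      toEnrichedBicategoryData.assocPastingRight a b c d e

/-! ### Right closed Gray monoids and their self-enrichment -/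

/-- A right closed structure on a Gray monoid: for every object `A`, a pseudofunctor `[A, -]` and
a pseudoadjunction `- ⊗ A ⊣ [A, -]`. -/
class RightClosed (V : Type u) [Bicategory.{w, v} V] [GrayMonoid V] where
  /-- The pseudofunctor `[A, -]`. -/
  ihom (A : V) : V ⥤ᵖ V
  /-- The pseudoadjunction `- ⊗ A ⊣ [A, -]`. -/
  adj (A : V) : Pseudoadjunction (tensorRight V A) (ihom A)

namespace RightClosed

variable {V : Type u} [Bicategory.{w, v} V] [GrayMonoid V] [RightClosed V]

/-- The internal hom `[a, b]`. -/
abbrev ho (a b : V) : V := (ihom a).obj b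

/-- `[a, f]` on 1-cells. -/
abbrev hoMap (a : V) {x y : V} (f : x ⟶ y) : ho a x ⟶ ho a y := (ihom a).map f

/-- `[a, θ]` on invertible 2-cells. -/
abbrev hoMap₂ (a : V) {x y : V} {f g : x ⟶ y} (θ : f ≅ g) : hoMap a f ≅ hoMap a g :=
  (ihom a).map₂Iso θ

/-- `η : x ⟶ [a, x ⊗ a]`. -/
def coev (a x : V) : x ⟶ ho a (x ⊠ a) := (adj a).unitApp x

/-- `ε : [a, y] ⊗ a ⟶ y`. -/
def ev (a y : V) : ho a y ⊠ a ⟶ y := (adj a).counitApp y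

/-- Pseudonaturality of `η`. -/
def coevNat (a : V) {x x' : V} (f : x ⟶ x') :
    f ≫ coev a x' ≅ coev a x ≫ hoMap a (rMap f a) := (adj a).unitNat f

/-- Pseudonaturality of `ε`. -/
def evNat (a : V) {y y' : V} (g : y ⟶ y') :
    rMap (hoMap a g) a ≫ ev a y' ≅ ev a y ≫ g := (adj a).counitNat g

/-- The triangulator `s`. -/
def triS (a x : V) : 𝟙 (x ⊠ a) ≅ rMap (coev a x) a ≫ ev a (x ⊠ a) := (adj a).s x

/-- The triangulator `t`. -/
def triT (a y : V) : coev a (ho a y) ≫ hoMap a (ev a y) ≅ 𝟙 (ho a y) := (adj a).t y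

/-- Composition
`m : [b,c] ⊗ [a,b] ⟶ [a, [b,c] ⊗ [a,b] ⊗ a] ⟶ [a, [b,c] ⊗ b] ⟶ [a,c]`, i.e. `η` followed by
`[1, 1 ⊗ ε]` and `[1, ε]`. -/
def selfComp (a b c : V) : ho b c ⊠ ho a b ⟶ ho a c :=
  coev a (ho b c ⊠ ho a b) ≫
    hoMap a (asc (ho b c) (ho a b) a ≫ lMap (ho b c) (ev a b)) ≫ hoMap a (ev b c)

/-- Unit `u : 1 ⟶ [a, 1 ⊗ a] = [a, a]`, i.e. `η`. -/
def selfUnit (a : V) : (tensorUnit : V) ⟶ ho a a :=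
  coev a tensorUnit ≫ eqToHom (congrArg (ho a) (unit_tensor a))

/-- The composite `m` with its last two factors merged by the functoriality of `[a, -]`. -/
def selfCompIso (a b c : V) :
    selfComp a b c ≅ coev a (ho b c ⊠ ho a b) ≫
      hoMap a ((asc (ho b c) (ho a b) a ≫ lMap (ho b c) (ev a b)) ≫ ev b c) :=
  whiskerLeftIso _ ((ihom a).mapComp _ _).symm

/-- Sliding `η` along a 1-cell `f`, by its pseudonaturality. -/
def slide {a x x' y : V} (f : x ⟶ x') (n : x' ⊠ a ⟶ y) :
    f ≫ coev a x' ≫ hoMap a n ≅ coev a x ≫ hoMap a (rMap f a ≫ n) :=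
  (α_ _ _ _).symm ≪≫ whiskerRightIso (coevNat a f) (hoMap a n) ≪≫ α_ _ _ _ ≪≫
    whiskerLeftIso (coev a x) ((ihom a).mapComp (rMap f a) n).symm

/-- The 2-cell `ε ∘ (m ⊗ 1) ⟶ ε ∘ (1 ⊗ ε)`: slide `ε` along `[1, ε]` and `[1, 1 ⊗ ε]` and apply
`s⁻¹` to the remaining `ε ∘ (η ⊗ 1)`. -/
def evComp (a b c : V) :
    rMap (selfComp a b c) a ≫ ev a c ≅
      asc (ho b c) (ho a b) a ≫ lMap (ho b c) (ev a b) ≫ ev b c :=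
  eqToIso (by simp [selfComp, rMap_comp]) ≪≫
  whiskerLeftIso (rMap (coev a (ho b c ⊠ ho a b)) a)
    (whiskerLeftIso (rMap (hoMap a (asc (ho b c) (ho a b) a ≫ lMap (ho b c) (ev a b))) a)
      (evNat a (ev b c)) ≪≫
    (α_ _ _ _).symm ≪≫
    whiskerRightIso (evNat a (asc (ho b c) (ho a b) a ≫ lMap (ho b c) (ev a b))) (ev b c)) ≪≫
  eqToIso (by simp) ≪≫
  whiskerRightIso (triS a (ho b c ⊠ ho a b)).symm
    (asc (ho b c) (ho a b) a ≫ lMap (ho b c) (ev a b) ≫ ev b c) ≪≫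
  λ_ _

/-- The 2-cell `ε ∘ (u ⊗ 1) ⟶ 1`, given by `s⁻¹`. -/
def evUnit (a : V) : rMap (selfUnit a) a ≫ ev a a ≅ lun a :=
  eqToIso (by
    have h := eqToHom_family (fun y => ev a y) (unit_tensor a)
    simp only [selfUnit, rMap_comp, rMap_eqToHom, Category.assoc]
    exact congrArg _ h) ≪≫
  whiskerRightIso (triS a tensorUnit).symm (lun a) ≪≫
  λ_ _

/-- The associator of the self-enrichment: both sides are brought to
`[1, ε] ∘ [1, 1 ⊗ ε] ∘ [1, 1 ⊗ 1 ⊗ ε] ∘ η` by sliding `η`; the left-hand side uses the interchange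
of `m ⊗ 1` and `1 ⊗ ε`, and `s⁻¹`; the right-hand side uses `1 ⊗ s⁻¹`, inverted. -/
def selfAssociator (a b c d : V) :
    rMap (selfComp b c d) (ho a b) ≫ selfComp a b d ≅
      asc (ho c d) (ho b c) (ho a b) ≫ lMap (ho c d) (selfComp a b c) ≫ selfComp a c d :=
  whiskerLeftIso _ (selfCompIso a b d) ≪≫
  slide _ _ ≪≫
  whiskerLeftIso (coev a ((ho c d ⊠ ho b c) ⊠ ho a b)) (hoMap₂ a
    (eqToIso (by simp [rMap_rMap_eq]) ≪≫
    whiskerLeftIso (asc (ho c d ⊠ ho b c) (ho a b) a)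
      (whiskerRightIso (interchanger (selfComp b c d) (ev a b)).symm (ev b d) ≪≫
      α_ _ _ _ ≪≫
      whiskerLeftIso (lMap (ho c d ⊠ ho b c) (ev a b)) (evComp b c d)) ≪≫
    eqToIso (by simp [lMap_tensor_eq, lMap_comp, lMap_eqToHom, rMap_eqToHom]) ≪≫
    (whiskerLeftIso (rMap (asc (ho c d) (ho b c) (ho a b)) a ≫
        asc (ho c d) (ho b c ⊠ ho a b) a)
      (whiskerRightIso ((lMap₂Iso (ho c d) (evComp a b c)).symm) (ev c d))) ≪≫
    eqToIso (by simp [rMap_comp, rMap_lMap_eq, lMap_comp]))) ≪≫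
  (slide _ _).symm ≪≫
  whiskerLeftIso _ (selfCompIso a c d).symm ≪≫
  α_ _ _ _

/-- The left unitor of the self-enrichment: slide `η`, interchange `u ⊗ 1` and `1 ⊗ ε`, apply
`s⁻¹`, and then `t`. -/
def selfLeftUnitor (a b : V) :
    rMap (selfUnit b) (ho a b) ≫ selfComp a b b ≅ lun (ho a b) :=
  whiskerLeftIso _ (selfCompIso a b b) ≪≫
  slide _ _ ≪≫
  whiskerLeftIso (coev a (tensorUnit ⊠ ho a b)) (hoMap₂ a
    (eqToIso (by simp [rMap_rMap_eq]) ≪≫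
    whiskerLeftIso (asc tensorUnit (ho a b) a)
      (whiskerRightIso (interchanger (selfUnit b) (ev a b)).symm (ev b b) ≪≫
      α_ _ _ _ ≪≫
      whiskerLeftIso (lMap tensorUnit (ev a b)) (evUnit b)) ≪≫
    eqToIso (by simp [lMap_unit_eq, rMap_eqToHom] : _ = rMap (lun (ho a b)) a ≫ ev a b))) ≪≫
  (slide _ _).symm ≪≫
  whiskerLeftIso (lun (ho a b)) (triT a b) ≪≫
  ρ_ _

/-- The right unitor of the self-enrichment: slide `η`, apply `1 ⊗ s⁻¹`, and then `t`. -/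
def selfRightUnitor (a b : V) :
    lMap (ho a b) (selfUnit a) ≫ selfComp a a b ≅ run (ho a b) :=
  whiskerLeftIso _ (selfCompIso a a b) ≪≫
  slide _ _ ≪≫
  whiskerLeftIso (coev a (ho a b ⊠ tensorUnit)) (hoMap₂ a
    (eqToIso (by simp [rMap_lMap_eq, lMap_comp]) ≪≫
    whiskerLeftIso (asc (ho a b) tensorUnit a)
      (whiskerRightIso (lMap₂Iso (ho a b) (evUnit a)) (ev a b)) ≪≫
    eqToIso (by simp [lMap_eqToHom, rMap_eqToHom] : _ = rMap (run (ho a b)) a ≫ ev a b))) ≪≫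
  (slide _ _).symm ≪≫
  whiskerLeftIso (run (ho a b)) (triT a b) ≪≫
  ρ_ _

variable (V) in
/-- The self-enrichment data of a right closed Gray monoid: objects those of `V`, hom-objects
`[a, b]`. -/
def selfEnrichmentData : EnrichedBicategoryData V V where
  hom := ho
  comp := selfComp
  unit := selfUnit
  associator := selfAssociator
  leftUnitor := selfLeftUnitor
  rightUnitor := selfRightUnitor

end RightClosed

/-! A 2-cell `θ : f ⟶ f'` between 1-cells into `[a, y]` is determined by its transpose `ε ∘ (θ ⊗
a)`: naturality of `η` recovers `η ∘ θ` from `θ ⊗ a`, and conjugation by `t` then recovers `θ`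
(`transpose_faithful`). It therefore suffices to check both coherence equations after transposition.

Transposition undoes the way the constraints were built. For `n : x ⊗ a ⟶ y` the cell `evCur`
evaluates the transpose of `[a, n] ∘ η` to `n`. It is natural in `n`, it turns a slide of `η` along
`f` into plain precomposition with `f ⊗ a` (`evCur_slide`, from the modification axiom for `s`), and
at `n = ε` it is the transpose of `t` (`transpose_triT`, from the swallowtail equation for `ε`).
Since `e_m` is `evCur` for the composite defining `m`, the transposes of `α`, `λ` and `ρ` become
pastings of `e_m`, `e_u` and inverse interchangers only (`transpose_selfAssociator`,
`transpose_selfLeftUnitor`, `transpose_selfRightUnitor`).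

Both coherence equations are then pasted with enough invertible `e_m` to reach an iterated
evaluation. What remains is exchange of 2-cells in disjoint positions and naturality and
multiplicativity of the interchanger; the added `e_m` are cancelled at the end.

The tensor product is strict only up to propositional equality, so the calculation takes place in
`Cell V`, where 2-cells forget their boundaries and composition is a total operation with an
undefined value. There `eqToHom` disappears, heterogeneous axioms become equations, and vertical
composition is a semigroup in which one can rewrite. -/

/-! ### Boundary-free 2-cells and their partial compositions -/

/-- A 2-cell of `V` with its boundary erased, or an undefined composite. -/
inductive Cell (V : Type u) [Bicategory.{w, v} V] : Type (max u v w)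
  | undef : Cell V
  | of {X Y : V} {f g : X ⟶ Y} (η : f ⟶ g) : Cell V

namespace Cell

variable {V : Type u} [Bicategory.{w, v} V]

/-- `z` is the vertical composite of `x` and `y`. -/
def IsVComp (x y z : Cell V) : Prop :=
  ∃ (X Y : V) (f g h : X ⟶ Y) (η : f ⟶ g) (θ : g ⟶ h), x = of η ∧ y = of θ ∧ z = of (η ≫ θ)

/-- `z` is the horizontal composite of `x` and `y`. -/
def IsHComp (x y z : Cell V) : Prop :=
  ∃ (X Y Z : V) (f f' : X ⟶ Y) (g g' : Y ⟶ Z) (η : f ⟶ f') (θ : g ⟶ g'),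
    x = of η ∧ y = of θ ∧ z = of (η ▷ g ≫ f' ◁ θ)

/-- The constructor `of` remembers its objects and 1-cells, so the composable pair underlying `x`
and `y` is unique; the choice made in defining the product is therefore immaterial. -/
theorem IsVComp.unique {x y z z' : Cell V} (h : IsVComp x y z) (h' : IsVComp x y z') : z = z' := by
  obtain ⟨X, Y, f, g, h, η, θ, rfl, rfl, rfl⟩ := h
  obtain ⟨X', Y', f', g', h', η', θ', e, e', rfl⟩ := h'
  cases e; cases e'; rfl

theorem IsHComp.unique {x y z z' : Cell V} (h : IsHComp x y z) (h' : IsHComp x y z') : z = z' := by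
  obtain ⟨X, Y, Z, f, f₁, g, g₁, η, θ, rfl, rfl, rfl⟩ := h
  obtain ⟨X', Y', Z', f', f₁', g', g₁', η', θ', e, e', rfl⟩ := h'
  cases e; cases e'; rfl

open Classical in
/-- Vertical composition, in diagrammatic order. -/
noncomputable instance : Mul (Cell V) where
  mul x y := if h : ∃ z, IsVComp x y z then h.choose else undef

open Classical in
/-- Horizontal composition, in diagrammatic order. -/
noncomputable def hcomp (x y : Cell V) : Cell V :=
  if h : ∃ z, IsHComp x y z then h.choose else undef

infixr:75 " ⊚ " => Cell.hcomp

theorem IsVComp.eq {x y z : Cell V} (h : IsVComp x y z) : x * y = z := by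
  have hz : ∃ z, IsVComp x y z := ⟨z, h⟩
  exact (dif_pos hz).trans (hz.choose_spec.unique h)

theorem IsHComp.eq {x y z : Cell V} (h : IsHComp x y z) : x ⊚ y = z := by
  have hz : ∃ z, IsHComp x y z := ⟨z, h⟩
  exact (dif_pos hz).trans (hz.choose_spec.unique h)

theorem of_comp {X Y : V} {f g h : X ⟶ Y} (η : f ⟶ g) (θ : g ⟶ h) :
    of (η ≫ θ) = of η * of θ :=
  (IsVComp.eq ⟨_, _, _, _, _, _, _, rfl, rfl, rfl⟩).symm

theorem of_hcomp {X Y Z : V} {f f' : X ⟶ Y} {g g' : Y ⟶ Z} (η : f ⟶ f') (θ : g ⟶ g') :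
    of η ⊚ of θ = of (η ▷ g ≫ f' ◁ θ) :=
  IsHComp.eq ⟨_, _, _, _, _, _, _, _, _, rfl, rfl, rfl⟩

theorem mul_cases (x y : Cell V) : (∃ (X Y : V) (f g h : X ⟶ Y) (η : f ⟶ g) (θ : g ⟶ h),
    x = of η ∧ y = of θ) ∨ x * y = undef := by
  by_cases h : ∃ z, IsVComp x y z
  · obtain ⟨z, X, Y, f, g, h, η, θ, hx, hy, -⟩ := h
    exact Or.inl ⟨X, Y, f, g, h, η, θ, hx, hy⟩
  · exact Or.inr (dif_neg h)

theorem hcomp_cases (x y : Cell V) : (∃ (X Y Z : V) (f f' : X ⟶ Y) (g g' : Y ⟶ Z) (η : f ⟶ f')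
    (θ : g ⟶ g'), x = of η ∧ y = of θ) ∨ x ⊚ y = undef := by
  by_cases h : ∃ z, IsHComp x y z
  · obtain ⟨z, X, Y, Z, f, f', g, g', η, θ, hx, hy, -⟩ := h
    exact Or.inl ⟨X, Y, Z, f, f', g, g', η, θ, hx, hy⟩
  · exact Or.inr (dif_neg h)

theorem undef_mul (x : Cell V) : undef * x = undef := by
  rcases mul_cases undef x with ⟨X, Y, f, g, h, η, θ, e, -⟩ | h
  · cases e
  · exact h

theorem mul_undef (x : Cell V) : x * undef = undef := by
  rcases mul_cases x undef with ⟨X, Y, f, g, h, η, θ, -, e⟩ | h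
  · cases e
  · exact h

theorem undef_hcomp (x : Cell V) : undef ⊚ x = undef := by
  rcases hcomp_cases undef x with ⟨X, Y, Z, f, f', g, g', η, θ, e, -⟩ | h
  · cases e
  · exact h

theorem hcomp_undef (x : Cell V) : x ⊚ undef = undef := by
  rcases hcomp_cases x undef with ⟨X, Y, Z, f, f', g, g', η, θ, -, e⟩ | h
  · cases e
  · exact h

/-- Associativity extends to undefined composites because composability of `η ≫ θ` with a further
cell on the right depends only on `θ`, and on the left only on `η`. -/
noncomputable instance : Semigroup (Cell V) where
  mul_assoc x y z := by
    rcases mul_cases x y with ⟨X, Y, f, g, h, η, θ, rfl, rfl⟩ | hxy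
    · rcases mul_cases (of θ) z with ⟨X', Y', f', g', h', θ', κ, e, rfl⟩ | hyz
      · cases e
        simp only [← of_comp, Category.assoc]
      · rw [hyz, mul_undef, ← of_comp]
        rcases mul_cases (of (η ≫ θ)) z with ⟨X', Y', f', g', h', θ', κ, e, rfl⟩ | h
        · cases e
          rw [← of_comp] at hyz; cases hyz
        · exact h
    · rw [hxy, undef_mul]
      rcases mul_cases y z with ⟨X, Y, f, g, h, η, θ, rfl, rfl⟩ | hyz
      · rw [← of_comp]
        rcases mul_cases x (of (η ≫ θ)) with ⟨X', Y', f', g', h', θ', κ, rfl, e⟩ | h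
        · cases e
          rw [← of_comp] at hxy; cases hxy
        · exact h.symm
      · rw [hyz, mul_undef]

/-- Allows an equation between short composites to be used at the head of a longer right-bracketed
one. -/
theorem mul_mul_eq {x y z : Cell V} (h : x * y = z) (w : Cell V) : x * (y * w) = z * w := by
  rw [← mul_assoc, h]

theorem mul_mul_mul_eq {x y z t : Cell V} (h : x * (y * z) = t) (w : Cell V) :
    x * (y * (z * w)) = t * w := by
  rw [← h, mul_assoc, mul_assoc]

theorem of_congr {X Y X' Y' : V} {f g : X ⟶ Y} {f' g' : X' ⟶ Y'} {η : f ⟶ g} {η' : f' ⟶ g'}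
    (hX : X = X') (hY : Y = Y') (hf : f ≍ f') (hg : g ≍ g') (h : η ≍ η') : of η = of η' := by
  cases hX; cases hY; cases hf; cases hg; cases h; rfl

/-- Equality of identity cells packages the equalities of objects and of 1-cells together, so
boundaries can be compared by `simp` without heterogeneous equalities. -/
theorem of_congr_of_one {X Y X' Y' : V} {f g : X ⟶ Y} {f' g' : X' ⟶ Y'} {η : f ⟶ g}
    {η' : f' ⟶ g'} (hf : of (𝟙 f) = of (𝟙 f')) (hg : of (𝟙 g) = of (𝟙 g')) (h : η ≍ η') :
    of η = of η' := by
  cases hf; cases hg; cases h; rfl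

theorem of_injective {X Y : V} {f g : X ⟶ Y} {η θ : f ⟶ g} (h : of η = of θ) : η = θ := by
  cases h; rfl

/-- The identity cell of a 1-cell. -/
def one {X Y : V} (f : X ⟶ Y) : Cell V := of (𝟙 f)

/-- The identity cell of an object. -/
def idC (X : V) : Cell V := one (𝟙 X)

@[simp] theorem one_id (X : V) : one (𝟙 X) = idC X := (rfl)

theorem of_id {X Y : V} (f : X ⟶ Y) : of (𝟙 f) = one f := rfl

@[simp] theorem one_eqToHom {X Y : V} (h : X = Y) : one (eqToHom h) = idC X := by
  cases h; rfl

-- This is where strictness bookkeeping disappears. The high priority lets it fire before `of_comp`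
-- splits the composite.
@[simp high]
theorem of_eqToHom_comp {X Y : V} {f g h : X ⟶ Y} (e : f = g) (η : g ⟶ h) :
    of (eqToHom e ≫ η) = of η := by
  cases e; simp

@[simp high]
theorem of_comp_eqToHom {X Y : V} {f g h : X ⟶ Y} (e : g = h) (η : f ⟶ g) :
    of (η ≫ eqToHom e) = of η := by
  cases e; simp

theorem of_whiskerLeft {X Y Z : V} (f : X ⟶ Y) {g g' : Y ⟶ Z} (θ : g ⟶ g') :
    of (f ◁ θ) = one f ⊚ of θ := by
  simp [one, of_hcomp]

theorem of_whiskerRight {X Y Z : V} {f f' : X ⟶ Y} (η : f ⟶ f') (g : Y ⟶ Z) :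
    of (η ▷ g) = of η ⊚ one g := by
  simp [one, of_hcomp]

@[simp]
theorem one_comp {X Y Z : V} (f : X ⟶ Y) (g : Y ⟶ Z) : one (f ≫ g) = one f ⊚ one g := by
  simp [one, of_hcomp]

/-! ### Boundaries, exchange and distributivity -/

/-- The source 1-cell. -/
def src : Cell V → Cell V
  | undef => undef
  | @of _ _ _ _ f _ _ => one f

/-- The target 1-cell. -/
def tgt : Cell V → Cell V
  | undef => undef
  | @of _ _ _ _ _ g _ => one g

/-- The source object. -/
def dom : Cell V → Cell V
  | undef => undef
  | @of _ _ X _ _ _ _ => idC X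

/-- The target object. -/
def cod : Cell V → Cell V
  | undef => undef
  | @of _ _ _ Y _ _ _ => idC Y

@[simp] theorem src_of {X Y : V} {f g : X ⟶ Y} (η : f ⟶ g) : src (of η) = one f := (rfl)
@[simp] theorem tgt_of {X Y : V} {f g : X ⟶ Y} (η : f ⟶ g) : tgt (of η) = one g := (rfl)
@[simp] theorem dom_of {X Y : V} {f g : X ⟶ Y} (η : f ⟶ g) : dom (of η) = idC X := (rfl)
@[simp] theorem cod_of {X Y : V} {f g : X ⟶ Y} (η : f ⟶ g) : cod (of η) = idC Y := (rfl)
@[simp] theorem src_one {X Y : V} (f : X ⟶ Y) : src (one f) = one f := (rfl)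
@[simp] theorem tgt_one {X Y : V} (f : X ⟶ Y) : tgt (one f) = one f := (rfl)
@[simp] theorem dom_one {X Y : V} (f : X ⟶ Y) : dom (one f) = idC X := (rfl)
@[simp] theorem cod_one {X Y : V} (f : X ⟶ Y) : cod (one f) = idC Y := (rfl)

@[simp] theorem tgt_idC (X : V) : tgt (idC X) = idC X := (rfl)

theorem of_hcomp_of_ne {X Y Y' Z : V} (h : Y ≠ Y') {f f' : X ⟶ Y} {g g' : Y' ⟶ Z} (η : f ⟶ f')
    (θ : g ⟶ g') : of η ⊚ of θ = undef := by
  rcases hcomp_cases (of η) (of θ) with ⟨X₁, Y₁, Z₁, f₁, f₁', g₁, g₁', η₁, θ₁, e, e'⟩ | h'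
  · cases e; cases e'; exact absurd rfl h
  · exact h'

/-- To prove a statement about two cells, treat the pairs which are horizontally composable, and
those which are not. -/
theorem hcomp_induction {P : Cell V → Cell V → Prop}
    (comp : ∀ (X Y Z : V) (f f' : X ⟶ Y) (g g' : Y ⟶ Z) (η : f ⟶ f') (θ : g ⟶ g'),
      P (of η) (of θ))
    (ne : ∀ (X Y Y' Z : V) (_ : Y ≠ Y') (f f' : X ⟶ Y) (g g' : Y' ⟶ Z) (η : f ⟶ f')
      (θ : g ⟶ g'), P (of η) (of θ))
    (left : ∀ y, P undef y) (right : ∀ x, P x undef) (x y : Cell V) : P x y := by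
  rcases x with _ | @⟨X, Y, f, f', η⟩
  · exact left _
  rcases y with _ | @⟨Y', Z, g, g', θ⟩
  · exact right _
  by_cases h : Y = Y'
  · subst h; exact comp _ _ _ _ _ _ _ _ _
  · exact ne _ _ _ _ h _ _ _ _ _ _

@[simp] theorem src_undef : src (undef : Cell V) = undef := (rfl)
@[simp] theorem tgt_undef : tgt (undef : Cell V) = undef := (rfl)

@[simp]
theorem src_hcomp (x y : Cell V) : src (x ⊚ y) = src x ⊚ src y := by
  induction x, y using hcomp_induction with
  | comp => rw [of_hcomp]; simp [src_of]
  | ne X Y Y' Z h => rw [of_hcomp_of_ne h]; simp [src_of, one, of_hcomp_of_ne h]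
  | left => simp [undef_hcomp]
  | right => simp [hcomp_undef]

@[simp]
theorem tgt_hcomp (x y : Cell V) : tgt (x ⊚ y) = tgt x ⊚ tgt y := by
  induction x, y using hcomp_induction with
  | comp => rw [of_hcomp]; simp [tgt_of]
  | ne X Y Y' Z h => rw [of_hcomp_of_ne h]; simp [tgt_of, one, of_hcomp_of_ne h]
  | left => simp [undef_hcomp]
  | right => simp [hcomp_undef]

@[simp] theorem dom_hcomp (x y : Cell V) (h : cod x = dom y) : dom (x ⊚ y) = dom x := by
  induction x, y using hcomp_induction with
  | comp => rw [of_hcomp]; rfl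
  | ne X Y Y' Z hne => cases h; exact absurd rfl hne
  | left => rw [undef_hcomp]
  | right x => cases x <;> cases h; rw [undef_hcomp]

/-- Whisker exchange. -/
theorem exchange (x y : Cell V) : (x ⊚ src y) * (tgt x ⊚ y) = (src x ⊚ y) * (x ⊚ tgt y) := by
  induction x, y using hcomp_induction with
  | comp =>
    simp only [src_of, tgt_of, ← of_whiskerLeft, ← of_whiskerRight, ← of_comp, whisker_exchange]
  | ne X Y Y' Z h => simp [src_of, tgt_of, one, of_hcomp_of_ne h, undef_mul]
  | left => simp [undef_hcomp, undef_mul]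
  | right => simp [hcomp_undef, undef_mul]

@[simp]
theorem mul_tgt (x : Cell V) : x * tgt x = x := by
  cases x
  · exact undef_mul _
  · rw [tgt_of, one, ← of_comp, Category.comp_id]

theorem mul_tgt_eq {x y : Cell V} (h : tgt x = y) : x * y = x := by
  rw [← h, mul_tgt]

@[simp]
theorem src_mul_self (x : Cell V) : src x * x = x := by
  cases x
  · exact undef_mul _
  · rw [src_of, one, ← of_comp, Category.id_comp]

theorem mul_cases_of_tgt_eq_src {x y : Cell V} (h : tgt x = src y) :
    (∃ (X Y : V) (f g h : X ⟶ Y) (η : f ⟶ g) (θ : g ⟶ h), x = of η ∧ y = of θ) ∨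
      x = undef ∧ y = undef := by
  rcases x with _ | @⟨X, Y, f, f', η⟩ <;> rcases y with _ | @⟨Y', Z, g, g', θ⟩
  · exact Or.inr ⟨rfl, rfl⟩
  · cases h
  · cases h
  · rw [tgt_of, src_of] at h
    cases h
    exact Or.inl ⟨_, _, _, _, _, _, _, rfl, rfl⟩

@[simp] theorem src_mul (x y : Cell V) (h : tgt x = src y) : src (x * y) = src x := by
  rcases mul_cases_of_tgt_eq_src h with ⟨X, Y, f, g, k, η, θ, rfl, rfl⟩ | ⟨rfl, rfl⟩
  · rw [← of_comp]; rfl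
  · rw [undef_mul]

@[simp] theorem tgt_mul (x y : Cell V) (h : tgt x = src y) : tgt (x * y) = tgt y := by
  rcases mul_cases_of_tgt_eq_src h with ⟨X, Y, f, g, k, η, θ, rfl, rfl⟩ | ⟨rfl, rfl⟩
  · rw [← of_comp]; rfl
  · rw [undef_mul]

/-- The condition `src z = z` says that `z` is an identity cell or undefined. Composability of `x`
and `y` has to be assumed, since whiskering may identify distinct 1-cells and so make an undefined
composite defined. -/
theorem whiskerLeft_mul (z x y : Cell V) (hz : src z = z) (h : tgt x = src y) :
    z ⊚ (x * y) = (z ⊚ x) * (z ⊚ y) := by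
  obtain _ | @⟨X, Y, f, f', θ⟩ := z
  · simp [undef_hcomp, undef_mul]
  rw [src_of] at hz
  cases hz
  rcases mul_cases_of_tgt_eq_src h with ⟨X', Y', f', g', k', η, θ, rfl, rfl⟩ | ⟨rfl, rfl⟩
  rotate_left
  · simp [hcomp_undef, undef_mul]
  · rw [← of_comp]
    by_cases hY : Y = X'
    · subst hY
      rw [of_id, ← of_whiskerLeft, ← of_whiskerLeft, ← of_whiskerLeft, ← of_comp,
        whiskerLeft_comp]
    · simp [of_hcomp_of_ne hY, undef_mul]

theorem mul_whiskerRight (x y z : Cell V) (hz : src z = z) (h : tgt x = src y) :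
    (x * y) ⊚ z = (x ⊚ z) * (y ⊚ z) := by
  obtain _ | @⟨X, Y, f, f', θ⟩ := z
  · simp [hcomp_undef, undef_mul]
  rw [src_of] at hz
  cases hz
  rcases mul_cases_of_tgt_eq_src h with ⟨X', Y', f', g', k', η, θ, rfl, rfl⟩ | ⟨rfl, rfl⟩
  rotate_left
  · simp [undef_hcomp, undef_mul]
  · rw [← of_comp]
    by_cases hY : Y' = X
    · subst hY
      rw [of_id, ← of_whiskerRight, ← of_whiskerRight, ← of_whiskerRight, ← of_comp,
        comp_whiskerRight]
    · simp [of_hcomp_of_ne hY, undef_mul]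

/-! ### Cancellation of invertible cells -/

/-- A cell with a right inverse. -/
def Cancellable (z : Cell V) : Prop := ∃ z', tgt z = src z' ∧ z * z' = src z

theorem cancellable_hom {X Y : V} {f g : X ⟶ Y} (e : f ≅ g) : Cancellable (of e.hom) :=
  ⟨of e.inv, rfl, by rw [← of_comp, e.hom_inv_id]; rfl⟩

theorem Cancellable.mul_right_cancel {x y z : Cell V} (hz : Cancellable z) (hx : tgt x = src z)
    (hy : tgt y = src z) (h : x * z = y * z) : x = y := by
  obtain ⟨z', -, h'⟩ := hz
  rw [← mul_tgt x, ← mul_tgt y, hx, hy, ← h', ← mul_assoc, h, mul_assoc]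

theorem Cancellable.whiskerLeft {z : Cell V} (hz : Cancellable z) (x : Cell V) (hx : src x = x) :
    Cancellable (x ⊚ z) := by
  obtain ⟨z', h, h'⟩ := hz
  have hx' : tgt x = x := by rw [← hx]; cases x <;> rfl
  exact ⟨x ⊚ z', by simp [h, hx, hx'], by rw [← whiskerLeft_mul _ _ _ hx h, h', src_hcomp, hx]⟩

theorem Cancellable.whiskerRight {z : Cell V} (hz : Cancellable z) (x : Cell V) (hx : src x = x) :
    Cancellable (z ⊚ x) := by
  obtain ⟨z', h, h'⟩ := hz
  have hx' : tgt x = x := by rw [← hx]; cases x <;> rfl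
  exact ⟨z' ⊚ x, by simp [h, hx, hx'], by rw [← mul_whiskerRight _ _ _ hx h, h', src_hcomp, hx]⟩

/-- Inverses are unique, so the interchanger axioms, stated for the forward direction, pass to
inverse interchangers. -/
theorem of_inv_congr {X Y X' Y' : V} {f g : X ⟶ Y} {f' g' : X' ⟶ Y'} {e : f ≅ g} {e' : f' ≅ g'}
    (h : of e.hom = of e'.hom) : of e.inv = of e'.inv := by
  obtain ⟨e, i, h₁, h₂⟩ := e
  obtain ⟨e', i', h₁', h₂'⟩ := e'
  cases h
  congr 1
  calc i = i ≫ e ≫ i' := by rw [h₁']; simp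
    _ = i' := by rw [reassoc_of% h₂]

/-! ### Strict associativity and unitality of horizontal composition -/

section Strict

variable [Bicategory.Strict V]

@[simp] theorem hcomp_assoc (x y z : Cell V) : (x ⊚ y) ⊚ z = x ⊚ y ⊚ z := by
  obtain _ | @⟨X₁, X₂, f, f', η⟩ := x
  · simp [undef_hcomp]
  obtain _ | @⟨X₃, X₄, g, g', θ⟩ := y
  · simp [undef_hcomp, hcomp_undef]
  obtain _ | @⟨X₅, X₆, k, k', κ⟩ := z
  · simp [hcomp_undef]
  by_cases h : X₂ = X₃
  · subst h
    rw [of_hcomp]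
    by_cases h' : X₄ = X₅
    · subst h'
      rw [of_hcomp, of_hcomp, of_hcomp]
      have : (η ▷ g ≫ f' ◁ θ) ▷ k ≫ (f' ≫ g') ◁ κ = eqToHom (Strict.assoc _ _ _) ≫
          (η ▷ (g ≫ k) ≫ f' ◁ (θ ▷ k ≫ g' ◁ κ)) ≫ eqToHom (Strict.assoc _ _ _).symm := by
        simp [Strict.associator_eqToIso]
      rw [this, of_eqToHom_comp, of_comp_eqToHom]
    · rw [of_hcomp_of_ne h', of_hcomp_of_ne h', hcomp_undef]
  · rw [of_hcomp_of_ne h, undef_hcomp]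
    by_cases h' : X₄ = X₅
    · subst h'
      rw [of_hcomp, of_hcomp_of_ne h]
    · rw [of_hcomp_of_ne h', hcomp_undef]

@[simp] theorem idC_hcomp (x : Cell V) {X : V} (h : dom x = idC X) : idC X ⊚ x = x := by
  obtain _ | @⟨X₁, X₂, f, f', η⟩ := x
  · cases h
  obtain rfl : X₁ = X := by
    rw [dom_of] at h; simp only [idC, one] at h; injection h
  rw [idC, ← of_whiskerLeft, id_whiskerLeft, Strict.leftUnitor_eqToIso, Strict.leftUnitor_eqToIso,
    eqToIso.hom, eqToIso.inv, of_eqToHom_comp, of_comp_eqToHom]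

@[simp high]
theorem one_eqToHom_comp {X Y Z : V} (h : X = Y) (f : Y ⟶ Z) : one (eqToHom h ≫ f) = one f := by
  cases h; rw [eqToHom_refl, Category.id_comp]

end Strict

/-! ### Whiskering by objects -/

section Gray

variable [GrayMonoid V]

/-- `A ⊗ x`. -/
def L (A : V) : Cell V → Cell V
  | undef => undef
  | of η => of (lMap₂ A η)

/-- `x ⊗ B`. -/
def R (B : V) : Cell V → Cell V
  | undef => undef
  | of η => of (rMap₂ η B)

@[simp] theorem of_lMap₂ (A : V) {X Y : V} {f g : X ⟶ Y} (η : f ⟶ g) :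
    of (lMap₂ A η) = L A (of η) := (rfl)

@[simp] theorem of_rMap₂ (B : V) {X Y : V} {f g : X ⟶ Y} (η : f ⟶ g) :
    of (rMap₂ η B) = R B (of η) := (rfl)

@[simp] theorem one_lMap (A : V) {X Y : V} (f : X ⟶ Y) : one (lMap A f) = L A (one f) := by
  rw [one, ← lMap₂_id]; rfl

@[simp] theorem one_rMap (B : V) {X Y : V} (f : X ⟶ Y) : one (rMap f B) = R B (one f) := by
  rw [one, ← rMap₂_id]; rfl

@[simp] theorem src_L (A : V) (x : Cell V) : src (L A x) = L A (src x) := by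
  cases x
  · rfl
  · exact one_lMap _ _

@[simp] theorem src_R (A : V) (x : Cell V) : src (R A x) = R A (src x) := by
  cases x
  · rfl
  · exact one_rMap _ _

@[simp] theorem tgt_L (A : V) (x : Cell V) : tgt (L A x) = L A (tgt x) := by
  cases x
  · rfl
  · exact one_lMap _ _

@[simp] theorem tgt_R (A : V) (x : Cell V) : tgt (R A x) = R A (tgt x) := by
  cases x
  · rfl
  · exact one_rMap _ _

@[simp] theorem L_idC (A X : V) : L A (idC X) = idC (A ⊠ X) := by
  rw [idC, ← one_lMap, lMap_id, one_id]

@[simp] theorem R_idC (A X : V) : R A (idC X) = idC (X ⊠ A) := by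
  rw [idC, ← one_rMap, rMap_id, one_id]

@[simp] theorem dom_L (A : V) (x : Cell V) : dom (L A x) = L A (dom x) := by
  cases x
  · rfl
  · rw [dom_of, L_idC]; rfl

@[simp] theorem dom_R (A : V) (x : Cell V) : dom (R A x) = R A (dom x) := by
  cases x
  · rfl
  · rw [dom_of, R_idC]; rfl

@[simp] theorem cod_L (A : V) (x : Cell V) : cod (L A x) = L A (cod x) := by
  cases x
  · rfl
  · rw [cod_of, L_idC]; rfl

@[simp] theorem cod_R (A : V) (x : Cell V) : cod (R A x) = R A (cod x) := by
  cases x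
  · rfl
  · rw [cod_of, R_idC]; rfl

theorem L_mul (A : V) (x y : Cell V) (h : tgt x = src y) : L A (x * y) = L A x * L A y := by
  rcases mul_cases_of_tgt_eq_src h with ⟨X, Y, f, g, k, η, θ, rfl, rfl⟩ | ⟨rfl, rfl⟩
  · rw [← of_comp, ← of_lMap₂, lMap₂_comp, of_comp]; rfl
  · rw [undef_mul, L, undef_mul]

theorem R_mul (A : V) (x y : Cell V) (h : tgt x = src y) : R A (x * y) = R A x * R A y := by
  rcases mul_cases_of_tgt_eq_src h with ⟨X, Y, f, g, k, η, θ, rfl, rfl⟩ | ⟨rfl, rfl⟩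
  · rw [← of_comp, ← of_rMap₂, rMap₂_comp, of_comp]; rfl
  · rw [undef_mul, R, undef_mul]

-- The boundary hypothesis excludes the case where `A ⊗ Y = A ⊗ Y'` for different `Y` and `Y'`, in
-- which only the right-hand side would be defined.
@[simp] theorem L_hcomp (A : V) (x y : Cell V) (h : cod x = dom y) :
    L A (x ⊚ y) = L A x ⊚ L A y := by
  induction x, y using hcomp_induction with
  | comp X Y Z f f' g g' η θ =>
    rw [of_hcomp, ← of_lMap₂, ← of_lMap₂, ← of_lMap₂, of_hcomp, lMap₂_comp, of_comp, of_comp]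
    congr 1
    · exact of_congr rfl rfl (heq_of_eq (lMap_comp ..)) (heq_of_eq (lMap_comp ..))
        (lMap₂_whiskerRight ..)
    · exact of_congr rfl rfl (heq_of_eq (lMap_comp ..)) (heq_of_eq (lMap_comp ..))
        (lMap₂_whiskerLeft ..)
  | ne X Y Y' Z hne => cases h; exact absurd rfl hne
  | left => rw [undef_hcomp, L, undef_hcomp]
  | right => rw [hcomp_undef, L, hcomp_undef]

@[simp] theorem R_hcomp (A : V) (x y : Cell V) (h : cod x = dom y) :
    R A (x ⊚ y) = R A x ⊚ R A y := by
  induction x, y using hcomp_induction with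
  | comp X Y Z f f' g g' η θ =>
    rw [of_hcomp, ← of_rMap₂, ← of_rMap₂, ← of_rMap₂, of_hcomp, rMap₂_comp, of_comp, of_comp]
    congr 1
    · exact of_congr rfl rfl (heq_of_eq (rMap_comp ..)) (heq_of_eq (rMap_comp ..))
        (rMap₂_whiskerRight ..)
    · exact of_congr rfl rfl (heq_of_eq (rMap_comp ..)) (heq_of_eq (rMap_comp ..))
        (rMap₂_whiskerLeft ..)
  | ne X Y Y' Z hne => cases h; exact absurd rfl hne
  | left => rw [undef_hcomp, R, undef_hcomp]
  | right => rw [hcomp_undef, R, hcomp_undef]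

@[simp] theorem R_R (A B : V) (x : Cell V) : R B (R A x) = R (A ⊠ B) x := by
  cases x
  · rfl
  · exact of_congr (tensor_assoc ..) (tensor_assoc ..) (rMap_rMap ..) (rMap_rMap ..)
      (rMap₂_rMap₂ ..)

@[simp] theorem R_L (A B : V) (x : Cell V) : R B (L A x) = L A (R B x) := by
  cases x
  · rfl
  · exact of_congr (tensor_assoc ..) (tensor_assoc ..) (rMap_lMap ..) (rMap_lMap ..)
      (rMap₂_lMap₂ ..)

@[simp] theorem L_L (A B : V) (x : Cell V) : L A (L B x) = L (A ⊠ B) x := by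
  cases x
  · rfl
  · exact (of_congr (tensor_assoc ..) (tensor_assoc ..) (lMap_tensor ..) (lMap_tensor ..)
      (lMap₂_tensor ..)).symm

@[simp] theorem L_unit (x : Cell V) : L tensorUnit x = x := by
  cases x
  · rfl
  · exact of_congr (unit_tensor _) (unit_tensor _) (lMap_unit _) (lMap_unit _) (lMap₂_unit _)

theorem Cancellable.L {z : Cell V} (hz : Cancellable z) (A : V) : Cancellable (L A z) := by
  obtain ⟨z', h, h'⟩ := hz
  exact ⟨Cell.L A z', by simp [h], by rw [← L_mul _ _ _ h, h', src_L]⟩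

/-! ### Calculus of inverse interchangers -/

/-- The inverse interchanger. -/
def ich {A A' B B' : V} (f : A ⟶ A') (g : B ⟶ B') : Cell V := of (interchanger f g).inv

variable {A A' A'' B B' B'' : V}

@[simp] theorem of_interchanger_inv (f : A ⟶ A') (g : B ⟶ B') :
    of (interchanger f g).inv = ich f g := (rfl)

@[simp] theorem src_ich (f : A ⟶ A') (g : B ⟶ B') :
    src (ich f g) = R B (one f) ⊚ L A' (one g) := by
  change one _ = _; simp

@[simp] theorem tgt_ich (f : A ⟶ A') (g : B ⟶ B') :
    tgt (ich f g) = L A (one g) ⊚ R B' (one f) := by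
  change one _ = _; simp

@[simp] theorem dom_ich (f : A ⟶ A') (g : B ⟶ B') : dom (ich f g) = idC (A ⊠ B) := (rfl)

@[simp] theorem cod_ich (f : A ⟶ A') (g : B ⟶ B') : cod (ich f g) = idC (A' ⊠ B') := (rfl)

theorem of_inv_congr_heq {X Y X' Y' : V} {f g : X ⟶ Y} {f' g' : X' ⟶ Y'} {e : f ≅ g}
    {e' : f' ≅ g'} (hf : one f = one f') (hg : one g = one g') (h : e.hom ≍ e'.hom) :
    of e.inv = of e'.inv :=
  of_inv_congr (of_congr_of_one hf hg h)

@[simp] theorem L_ich (C : V) (f : A ⟶ A') (g : B ⟶ B') : L C (ich f g) = ich (lMap C f) g :=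
  of_inv_congr_heq (e := lMap₂Iso C (interchanger f g)) (by simp [lMap_comp])
    (by simp [lMap_comp]) (lMap₂_interchanger C f g)

theorem ich_rMap (C : V) (f : A ⟶ A') (g : B ⟶ B') : ich (rMap f C) g = ich f (lMap C g) :=
  of_inv_congr_heq (by simp) (by simp) (interchanger_rMap_lMap f C g)

theorem R_ich (C : V) (f : A ⟶ A') (g : B ⟶ B') : R C (ich f g) = ich f (rMap g C) :=
  of_inv_congr_heq (e := ⟨rMap₂ (interchanger f g).hom C, rMap₂ (interchanger f g).inv C,
      by rw [← rMap₂_comp, Iso.hom_inv_id, rMap₂_id],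
      by rw [← rMap₂_comp, Iso.inv_hom_id, rMap₂_id]⟩)
    (by simp [rMap_comp]) (by simp [rMap_comp]) (rMap₂_interchanger f g C)

theorem ich_id_left (A : V) (g : B ⟶ B') : ich (𝟙 A) g = L A (one g) :=
  (of_inv_congr_heq (e' := Iso.refl _) (by simp [rMap_id]) (by simp [rMap_id])
    (interchanger_id_left A g)).trans (one_lMap A g)

theorem ich_eqToHom_comp (h : A = A') (f : A' ⟶ A'') (g : B ⟶ B') :
    ich (eqToHom h ≫ f) g = ich f g := by
  cases h; rw [eqToHom_refl, Category.id_comp]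

theorem ich_eqToHom (h : A = A') (g : B ⟶ B') : ich (eqToHom h) g = L A (one g) := by
  cases h; exact ich_id_left A g

theorem ich_comp_eqToHom (f : A ⟶ A') (h : B = B') (g : B' ⟶ B'') :
    ich f (eqToHom h ≫ g) = ich f g := by
  cases h; rw [eqToHom_refl, Category.id_comp]

theorem ich_comp_left (f : A ⟶ A') (f' : A' ⟶ A'') (g : B ⟶ B') :
    ich (f ≫ f') g = (R B (one f) ⊚ ich f' g) * (ich f g ⊚ R B' (one f')) := by
  have h : ich (f ≫ f') g = of ((α_ (lMap A g) (rMap f B') (rMap f' B')).symm ≪≫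
      whiskerRightIso (interchanger f g) (rMap f' B') ≪≫ α_ _ _ _ ≪≫
      whiskerLeftIso (rMap f B) (interchanger f' g) ≪≫ (α_ _ _ _).symm).inv :=
    of_inv_congr_heq (by simp [rMap_comp]) (by simp [rMap_comp])
      ((interchanger_comp_left f f' g).trans (by simp))
  rw [h]
  simp [Strict.associator_eqToIso, of_comp, of_whiskerLeft, of_whiskerRight]

theorem ich_comp_right (f : A ⟶ A') (g : B ⟶ B') (g' : B' ⟶ B'') :
    ich f (g ≫ g') = (ich f g ⊚ L A' (one g')) * (L A (one g) ⊚ ich f g') := by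
  have h : ich f (g ≫ g') = of (α_ (lMap A g) (lMap A g') (rMap f B'') ≪≫
      whiskerLeftIso (lMap A g) (interchanger f g') ≪≫ (α_ _ _ _).symm ≪≫
      whiskerRightIso (interchanger f g) (lMap A' g') ≪≫ α_ _ _ _).inv :=
    of_inv_congr_heq (by simp [lMap_comp]) (by simp [lMap_comp])
      ((interchanger_comp_right f g g').trans (by simp))
  rw [h]
  simp [Strict.associator_eqToIso, of_comp, of_whiskerLeft, of_whiskerRight]

/-- Joint naturality of the interchanger with an identity in the second variable, solved for the
inverses. -/
theorem ich_naturality_left {f f' : A ⟶ A'} (α : f ⟶ f') (g : B ⟶ B') :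
    (R B (of α) ⊚ L A' (one g)) * ich f' g = ich f g * (L A (one g) ⊚ R B' (of α)) := by
  have h := interchanger_naturality α (𝟙 g)
  rw [lMap₂_id, lMap₂_id, id_whiskerRight, whiskerLeft_id, Category.id_comp, Category.comp_id,
    ← Iso.eq_comp_inv, Category.assoc, ← Iso.inv_comp_eq] at h
  simpa [of_comp, of_whiskerLeft, of_whiskerRight] using (congrArg of h).symm

theorem ich_naturality_right (f : A ⟶ A') {g g' : B ⟶ B'} (β : g ⟶ g') :
    (R B (one f) ⊚ L A' (of β)) * ich f g' = ich f g * (L A (of β) ⊚ R B' (one f)) := by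
  have h := interchanger_naturality (𝟙 f) β
  rw [rMap₂_id, rMap₂_id, id_whiskerRight, whiskerLeft_id, Category.id_comp, Category.id_comp,
    ← Iso.eq_comp_inv, Category.assoc, ← Iso.inv_comp_eq] at h
  simpa [of_comp, of_whiskerLeft, of_whiskerRight] using (congrArg of h).symm

end Gray

end Cell

namespace RightClosed

open Cell

variable {V : Type u} [Bicategory.{w, v} V] [GrayMonoid V] [RightClosed V]

/-! ### The structure 2-cells of the closed structure -/

/-- This and the four statements that follow are axioms of the pseudoadjunction; the functoriality
constraints of `- ⊗ a` appear as `eqToHom` because it is a strict 2-functor. -/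
theorem evNat_naturality (a : V) {y y' : V} {g g' : y ⟶ y'} (θ : g ⟶ g') :
    rMap₂ ((ihom a).map₂ θ) a ▷ ev a y' ≫ (evNat a g').hom = (evNat a g).hom ≫ ev a y ◁ θ :=
  (adj a).counit.naturality_naturality θ

theorem coevNat_naturality (a : V) {x x' : V} {f f' : x ⟶ x'} (θ : f ⟶ f') :
    θ ▷ coev a x' ≫ (coevNat a f').hom =
      (coevNat a f).hom ≫ coev a x ◁ (ihom a).map₂ (rMap₂ θ a) :=
  (adj a).unit.naturality_naturality θ

theorem evNat_comp (a : V) {y y' y'' : V} (g : y ⟶ y') (g' : y' ⟶ y'') :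
    (evNat a (g ≫ g')).hom ≫ ev a y ◁ 𝟙 (g ≫ g') =
      (rMap₂ ((ihom a).mapComp g g').hom a ≫ eqToHom (rMap_comp _ _ _)) ▷ ev a y'' ≫
        (α_ _ _ _).hom ≫ rMap (hoMap a g) a ◁ (evNat a g').hom ≫ (α_ _ _ _).inv ≫
        (evNat a g).hom ▷ g' ≫ (α_ _ _ _).hom :=
  (adj a).counit.naturality_comp g g'

theorem triS_modification (a : V) {x x' : V} (f : x ⟶ x') :
    rMap f a ◁ (triS a x').hom ≫
      (α_ _ _ _).inv ≫ (eqToHom (rMap_comp _ _ _).symm ≫ rMap₂ (coevNat a f).hom a ≫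
        eqToHom (rMap_comp _ _ _)) ▷ ev a (x' ⊠ a) ≫
      (α_ _ _ _).hom ≫ rMap (coev a x) a ◁ (evNat a (rMap f a)).hom ≫ (α_ _ _ _).inv =
    (ρ_ (rMap f a)).hom ≫ (λ_ (rMap f a)).inv ≫ (triS a x).hom ▷ rMap f a :=
  (adj a).s_modification f

theorem swallowtail_ev (a y : V) :
    (λ_ (ev a y)).inv ≫ (triS a (ho a y)).hom ▷ ev a y ≫ (α_ _ _ _).hom ≫
      rMap (coev a (ho a y)) a ◁ (evNat a (ev a y)).inv ≫ (α_ _ _ _).inv ≫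
      (eqToHom (rMap_comp _ _ _).symm ≫ rMap₂ (triT a y).hom a ≫ eqToHom (rMap_id _ _)) ▷ ev a y ≫
      (λ_ (ev a y)).hom = 𝟙 (ev a y) :=
  (adj a).swallowtail_counit y

/-- Transposition of 2-cells along `- ⊗ a ⊣ [a, -]` is faithful. -/
theorem transpose_faithful (a : V) {x y : V} {f f' : x ⟶ ho a y} {θ θ' : f ⟶ f'}
    (h : rMap₂ θ a ▷ ev a y = rMap₂ θ' a ▷ ev a y) : θ = θ' := by
  have h₁ : (ihom a).map₂ (rMap₂ θ a) ▷ hoMap a (ev a y) =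
      (ihom a).map₂ (rMap₂ θ' a) ▷ hoMap a (ev a y) := by
    have := congrArg (ihom a).map₂ h
    simpa using this
  -- Naturality of `η` expresses `κ ▷ η` through `κ ⊗ a`, so the left-hand side depends only on the
  -- transpose of `κ`.
  have h₂ (κ : f ⟶ f') : (κ ▷ coev a (ho a y)) ▷ hoMap a (ev a y) =
      (coevNat a f).hom ▷ _ ≫ (α_ _ _ _).hom ≫
        coev a x ◁ ((ihom a).map₂ (rMap₂ κ a) ▷ hoMap a (ev a y)) ≫ (α_ _ _ _).inv ≫
          (coevNat a f').inv ▷ _ := by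
    have := (Iso.eq_comp_inv _).2 (coevNat_naturality a κ)
    rw [this]
    simp
  have h₃ : θ ▷ (coev a (ho a y) ≫ hoMap a (ev a y)) =
      θ' ▷ (coev a (ho a y) ≫ hoMap a (ev a y)) := by
    simp only [whiskerRight_comp, h₂, h₁]
  -- Whiskering by a 1-cell isomorphic to the identity, here through `t`, loses no information.
  have h₄ (κ : f ⟶ f') : κ = (ρ_ f).inv ≫ f ◁ (triT a y).inv ≫
      κ ▷ (coev a (ho a y) ≫ hoMap a (ev a y)) ≫ f' ◁ (triT a y).hom ≫ (ρ_ f').hom := by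
    rw [← whisker_exchange_assoc]
    simp
  rw [h₄ θ, h₄ θ', h₃]

/-! ### Cells of the closed structure -/

/-- The cell of `ε`. -/
def evC (a y : V) : Cell V := one (ev a y)

/-- The cell of `η`. -/
def coevC (a x : V) : Cell V := one (coev a x)

/-- The cell of the composition `m`. -/
def compC (a b c : V) : Cell V := one (selfComp a b c)

/-- The cell of the unit `u`. -/
def unitC (a : V) : Cell V := one (selfUnit a)

@[simp] theorem one_ev (a y : V) : one (ev a y) = evC a y := (rfl)
@[simp] theorem one_coev (a x : V) : one (coev a x) = coevC a x := (rfl)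
@[simp] theorem one_selfComp (a b c : V) : one (selfComp a b c) = compC a b c := (rfl)
@[simp] theorem one_selfUnit (a : V) : one (selfUnit a) = unitC a := (rfl)

@[simp] theorem src_evC (a y : V) : src (evC a y) = evC a y := (rfl)
@[simp] theorem tgt_evC (a y : V) : tgt (evC a y) = evC a y := (rfl)
@[simp] theorem dom_evC (a y : V) : dom (evC a y) = idC (ho a y ⊠ a) := (rfl)
@[simp] theorem cod_evC (a y : V) : cod (evC a y) = idC y := (rfl)
@[simp] theorem src_coevC (a x : V) : src (coevC a x) = coevC a x := (rfl)
@[simp] theorem tgt_coevC (a x : V) : tgt (coevC a x) = coevC a x := (rfl)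
@[simp] theorem dom_coevC (a x : V) : dom (coevC a x) = idC x := (rfl)
@[simp] theorem cod_coevC (a x : V) : cod (coevC a x) = one (𝟙 (ho a (x ⊠ a))) := (rfl)
@[simp] theorem src_compC (a b c : V) : src (compC a b c) = compC a b c := (rfl)
@[simp] theorem tgt_compC (a b c : V) : tgt (compC a b c) = compC a b c := (rfl)
@[simp] theorem dom_compC (a b c : V) : dom (compC a b c) = idC (ho b c ⊠ ho a b) := (rfl)
@[simp] theorem cod_compC (a b c : V) : cod (compC a b c) = idC (ho a c) := (rfl)
@[simp] theorem src_unitC (a : V) : src (unitC a) = unitC a := (rfl)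
@[simp] theorem tgt_unitC (a : V) : tgt (unitC a) = unitC a := (rfl)
@[simp] theorem cod_unitC (a : V) : cod (unitC a) = idC (ho a a) := (rfl)

/-! ### Transposition of cells and evaluation of curried 1-cells -/

/-- The transpose of a cell with target object `[a, y]`. -/
noncomputable def transpose (a y : V) (x : Cell V) : Cell V := R a x ⊚ evC a y

theorem transpose_of {a x y : V} {f f' : x ⟶ ho a y} (θ : f ⟶ f') :
    transpose a y (of θ) = of (rMap₂ θ a ▷ ev a y) := by
  simp [transpose, of_whiskerRight]

theorem transpose_of_comp {a x y : V} {f f' f'' : x ⟶ ho a y} (θ : f ⟶ f') (θ' : f' ⟶ f'') :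
    transpose a y (of (θ ≫ θ')) = transpose a y (of θ) * transpose a y (of θ') := by
  rw [transpose_of, transpose_of, transpose_of, rMap₂_comp, comp_whiskerRight, of_comp]

theorem transpose_of_whiskerLeft {a x x' y : V} (g : x ⟶ x') {f f' : x' ⟶ ho a y} (θ : f ⟶ f') :
    transpose a y (of (g ◁ θ)) = R a (one g) ⊚ transpose a y (of θ) := by
  rw [of_whiskerLeft, transpose, R_hcomp _ _ _ rfl, hcomp_assoc, transpose]

theorem eq_of_transpose {a x y : V} {f f' : x ⟶ ho a y} {θ θ' : f ⟶ f'}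
    (h : transpose a y (of θ) = transpose a y (of θ')) : θ = θ' := by
  rw [transpose_of, transpose_of] at h
  exact transpose_faithful a (of_injective h)

/-- The cell of the pseudonaturality of `ε`. -/
def evNatC (a : V) {y y' : V} (g : y ⟶ y') : Cell V := of (evNat a g).hom

@[simp] theorem of_evNat_hom (a : V) {y y' : V} (g : y ⟶ y') :
    of (evNat a g).hom = evNatC a g := (rfl)

@[simp] theorem src_evNatC (a : V) {y y' : V} (g : y ⟶ y') :
    src (evNatC a g) = R a (one (hoMap a g)) ⊚ evC a y' := by
  change one _ = _; simp

@[simp] theorem tgt_evNatC (a : V) {y y' : V} (g : y ⟶ y') :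
    tgt (evNatC a g) = evC a y ⊚ one g := by
  change one _ = _; simp

/-- The cell of `s⁻¹`. -/
def triSC (a x : V) : Cell V := of (triS a x).inv

@[simp] theorem of_triS_inv (a x : V) : of (triS a x).inv = triSC a x := (rfl)

@[simp] theorem src_triSC (a x : V) : src (triSC a x) = R a (coevC a x) ⊚ evC a (x ⊠ a) := by
  change one _ = _; simp

@[simp] theorem tgt_triSC (a x : V) : tgt (triSC a x) = idC (x ⊠ a) := (rfl)

/-- The cell of the 2-cell `ε ∘ (([a, n] ∘ η) ⊗ a) ⟶ n`, for `n : x ⊗ a ⟶ y`. -/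
noncomputable def evCur (a x : V) {y : V} (n : x ⊠ a ⟶ y) : Cell V :=
  (R a (coevC a x) ⊚ evNatC a n) * (triSC a x ⊚ one n)

/-- The cell `θ` passes `ε` by naturality of its constraint, and then passes `s⁻¹` by exchange. -/
theorem evCur_naturality (a x : V) {y : V} {n n' : x ⊠ a ⟶ y} (θ : n ⟶ n') :
    transpose a y (of (coev a x ◁ (ihom a).map₂ θ)) * evCur a x n' = evCur a x n * of θ := by
  have h := congrArg of (evNat_naturality a θ)
  simp only [of_comp, of_whiskerLeft, of_whiskerRight, of_rMap₂, one_ev] at h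
  change _ * evNatC a n' = evNatC a n * _ at h
  have h' := exchange (triSC a x) (of θ)
  simp only [src_of, tgt_of, tgt_triSC, src_triSC, idC_hcomp _ (dom_of θ), hcomp_assoc] at h'
  rw [transpose_of_whiskerLeft, transpose, one_coev, evCur, evCur, ← mul_assoc,
    ← whiskerLeft_mul _ _ _ (by simp) (by simp [tgt_of]), h,
    whiskerLeft_mul _ _ _ (by simp) (by simp [src_of]), mul_assoc, mul_assoc, h']

theorem evNat_comp_cell (a : V) {y y' y'' : V} (g : y ⟶ y') (g' : y' ⟶ y'') :
    (R a (of ((ihom a).mapComp g g').inv) ⊚ evC a y'') * evNatC a (g ≫ g') =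
      (R a (one (hoMap a g)) ⊚ evNatC a g') * (evNatC a g ⊚ one g') := by
  have h := evNat_comp a g g'
  rw [whiskerLeft_id, Category.comp_id] at h
  have h' : rMap₂ ((ihom a).mapComp g g').inv a ▷ ev a y'' ≫ (evNat a (g ≫ g')).hom =
      eqToHom (rMap_comp _ _ _) ▷ ev a y'' ≫ (α_ _ _ _).hom ≫
        rMap (hoMap a g) a ◁ (evNat a g').hom ≫ (α_ _ _ _).inv ≫
        (evNat a g).hom ▷ g' ≫ (α_ _ _ _).hom := by
    rw [h, comp_whiskerRight, Category.assoc, ← comp_whiskerRight_assoc, ← rMap₂_comp,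
      Iso.inv_hom_id, rMap₂_id, id_whiskerRight, Category.id_comp]
  simpa [of_comp, of_whiskerLeft, of_whiskerRight, Strict.associator_eqToIso] using congrArg of h'

theorem triS_cell (a : V) {x x' : V} (f : x ⟶ x') :
    (R a (of (coevNat a f).hom) ⊚ evC a (x' ⊠ a)) * (R a (coevC a x) ⊚ evNatC a (rMap f a)) *
      (triSC a x ⊚ R a (one f)) = R a (one f) ⊚ triSC a x' := by
  have h := triS_modification a f
  have h' : ((α_ _ _ _).inv ≫ (eqToHom (rMap_comp _ _ _).symm ≫ rMap₂ (coevNat a f).hom a ≫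
        eqToHom (rMap_comp _ _ _)) ▷ ev a (x' ⊠ a) ≫
      (α_ _ _ _).hom ≫ rMap (coev a x) a ◁ (evNat a (rMap f a)).hom ≫ (α_ _ _ _).inv) ≫
      (triS a x).inv ▷ rMap f a =
      rMap f a ◁ (triS a x').inv ≫ (ρ_ (rMap f a)).hom ≫ (λ_ (rMap f a)).inv := by
    rw [← cancel_epi (rMap f a ◁ (triS a x').hom), ← Category.assoc, h]
    simp
  simpa [of_comp, of_whiskerLeft, of_whiskerRight, Strict.associator_eqToIso,
    Strict.leftUnitor_eqToIso, Strict.rightUnitor_eqToIso, mul_assoc] using congrArg of h'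

/-- The functoriality constraint inside `slide` merges with the constraint of `ε` at a composite,
splitting it in two. After an exchange, the part at `f ⊗ a` joins the constraint of `η` at `f`, and
the modification axiom for `s` absorbs both. -/
theorem evCur_slide {a x x' y : V} (f : x ⟶ x') (n : x' ⊠ a ⟶ y) :
    transpose a y (of (slide f n).hom) * evCur a x (rMap f a ≫ n) =
      R a (one f) ⊚ evCur a x' n := by
  have h := evNat_comp_cell a (rMap f a) n
  have hs := triS_cell a f
  have h₁ := exchange (R a (of (coevNat a f).hom)) (evNatC a n)
  simp at h₁
  have hT : transpose a y (of (slide f n).hom) =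
      (R a (of (coevNat a f).hom) ⊚ R a (one (hoMap a n)) ⊚ evC a y) *
        (R a (coevC a x) ⊚ R a (of ((ihom a).mapComp (rMap f a) n).inv) ⊚ evC a y) := by
    have : of (slide f n).hom =
        of ((coevNat a f).hom ▷ _ ≫ (α_ _ _ _).hom ≫
          coev a x ◁ ((ihom a).mapComp (rMap f a) n).inv) := by
      simp [slide, Strict.associator_eqToIso]
    rw [this, transpose_of_comp, Strict.associator_eqToIso, eqToIso.hom]
    simp [of_whiskerLeft, of_whiskerRight, transpose]
  rw [hT, evCur, evCur, whiskerLeft_mul _ _ _ (by simp) (by simp), ← hcomp_assoc _ (triSC a x'),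
    ← hs, mul_whiskerRight _ _ _ (by simp) (by simp),
    mul_whiskerRight _ _ _ (by simp) (by simp)]
  have h₂ := congrArg (R a (coevC a x) ⊚ ·) h
  simp [whiskerLeft_mul] at h₂
  simp only [one_comp, hcomp_assoc, one_rMap, mul_assoc]
  rw [mul_mul_eq h₂, mul_assoc, mul_mul_eq h₁, mul_assoc]

/-- The 2-cell `evCur` of `ε` is the transpose of `t`. -/
theorem transpose_triT (a y : V) :
    transpose a y (of (triT a y).hom) = evCur a (ho a y) (ev a y) := by
  -- The swallowtail equation reads: `e` followed by the transpose of `t` is the identity. Hence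
  -- that transpose is `e⁻¹`, which is `evCur` at `ε`.
  let e : ev a y ≅ (rMap (coev a (ho a y)) a ≫ rMap (hoMap a (ev a y)) a) ≫ ev a y :=
    (λ_ (ev a y)).symm ≪≫ whiskerRightIso (triS a (ho a y)) (ev a y) ≪≫ α_ _ _ _ ≪≫
      whiskerLeftIso (rMap (coev a (ho a y)) a) (evNat a (ev a y)).symm ≪≫ (α_ _ _ _).symm
  have h : e.hom ≫ (eqToHom (rMap_comp _ _ _).symm ≫ rMap₂ (triT a y).hom a ≫
      eqToHom (rMap_id _ _)) ▷ ev a y ≫ (λ_ (ev a y)).hom = 𝟙 (ev a y) := by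
    rw [← swallowtail_ev]
    simp [e]
  have h' := congrArg of ((Iso.eq_inv_comp e).2 h)
  simp [e, of_comp, of_whiskerLeft, of_whiskerRight, Strict.associator_eqToIso,
    Strict.leftUnitor_eqToIso] at h'
  simpa [transpose, evCur] using h'

theorem transpose_inv_mul {a x y : V} {f f' : x ⟶ ho a y} (θ : f ≅ f') {z w : Cell V}
    (h : transpose a y (of θ.hom) * z = w) (hz : src z = R a (one f') ⊚ evC a y) :
    transpose a y (of θ.inv) * w = z := by
  rw [← h, ← mul_assoc, ← transpose_of_comp, θ.inv_hom_id, of_id, transpose, ← hz, src_mul_self]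

/-- Evaluating a merged composite agrees with sliding `ε` past its two factors in turn, which is the
form in which `evComp` is defined. -/
theorem evCur_comp (a x : V) {z y : V} (k : x ⊠ a ⟶ z) (n : z ⟶ y) :
    transpose a y (of (coev a x ◁ ((ihom a).mapComp k n).inv)) * evCur a x (k ≫ n) =
      (R a (coevC a x) ⊚ R a (one (hoMap a k)) ⊚ evNatC a n) *
        (R a (coevC a x) ⊚ evNatC a k ⊚ one n) * (triSC a x ⊚ one k ⊚ one n) := by
  have h := congrArg (R a (coevC a x) ⊚ ·) (evNat_comp_cell a k n)
  simp [whiskerLeft_mul] at h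
  rw [transpose_of_whiskerLeft, evCur, transpose, one_coev, mul_mul_eq h, one_comp]

/-! ### Evaluation of composition and units -/

/-- The cell of `ε ∘ (m ⊗ 1) ⟶ ε ∘ (1 ⊗ ε)`. -/
def evCompC (a b c : V) : Cell V := of (evComp a b c).hom

/-- The cell of `ε ∘ (u ⊗ 1) ⟶ 1`. -/
def evUnitC (a : V) : Cell V := of (evUnit a).hom

@[simp] theorem of_evComp_hom (a b c : V) : of (evComp a b c).hom = evCompC a b c := (rfl)
@[simp] theorem of_evUnit_hom (a : V) : of (evUnit a).hom = evUnitC a := (rfl)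

@[simp] theorem src_evCompC (a b c : V) :
    src (evCompC a b c) = R a (compC a b c) ⊚ evC a c := by
  change one _ = _; simp

@[simp] theorem tgt_evCompC (a b c : V) :
    tgt (evCompC a b c) = L (ho b c) (evC a b) ⊚ evC b c := by
  change one _ = _; simp

@[simp] theorem dom_evCompC (a b c : V) :
    dom (evCompC a b c) = idC (ho b c ⊠ ho a b ⊠ a) := by
  change idC ((ho b c ⊠ ho a b) ⊠ a) = _
  rw [tensor_assoc]

@[simp] theorem cod_evCompC (a b c : V) : cod (evCompC a b c) = idC c := (rfl)

@[simp] theorem src_evUnitC (a : V) : src (evUnitC a) = R a (unitC a) ⊚ evC a a := by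
  change one _ = _; simp

@[simp] theorem dom_evUnitC (a : V) : dom (evUnitC a) = idC a := by
  change idC (tensorUnit ⊠ a) = _
  rw [unit_tensor]

@[simp] theorem cod_evUnitC (a : V) : cod (evUnitC a) = idC a := (rfl)

attribute [local simp] tensor_assoc unit_tensor tensor_unit

theorem transpose_selfCompIso (a b c : V) :
    transpose a c (of (selfCompIso a b c).hom) *
      evCur a (ho b c ⊠ ho a b) ((asc (ho b c) (ho a b) a ≫ lMap (ho b c) (ev a b)) ≫ ev b c) =
    evCompC a b c := by
  refine (evCur_comp a _ _ _).trans ?_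
  rw [← of_evComp_hom]
  simp [evComp, of_comp, of_whiskerLeft, of_whiskerRight, Strict.associator_eqToIso,
    Strict.leftUnitor_eqToIso, mul_assoc]

/-- The common shape of the three constraints: unfold, slide `η`, apply `[a, Θ]`, slide back,
refold. On transposes each slide is absorbed by `evCur`, and `[a, Θ]` becomes `Θ` by naturality, so
only evaluation followed by `Θ` survives. -/
theorem transpose_slide_conj {a x x' x'' y : V} (f : x ⟶ x') {n : x' ⊠ a ⟶ y} (f' : x ⟶ x'')
    {n' : x'' ⊠ a ⟶ y} {g : x' ⟶ ho a y} {k : x ⟶ ho a y} (I : g ≅ coev a x' ≫ hoMap a n)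
    (Θ : rMap f a ≫ n ≅ rMap f' a ≫ n') (K : f' ≫ coev a x'' ≫ hoMap a n' ≅ k) {w z : Cell V}
    (hI : transpose a y (of I.hom) * evCur a x' n = w)
    (hK : transpose a y (of K.hom) * z = R a (one f') ⊚ evCur a x'' n') :
    transpose a y (of (whiskerLeftIso f I ≪≫ slide f n ≪≫
      whiskerLeftIso (coev a x) (hoMap₂ a Θ) ≪≫ (slide f' n').symm ≪≫ K).hom) * z =
      (R a (one f) ⊚ w) * of Θ.hom := by
  have h₁ := transpose_inv_mul _ (evCur_slide f' n') (by simp [evCur])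
  have h₂ := evCur_naturality a x Θ.hom
  rw [transpose_of_whiskerLeft] at h₂
  simp only [Iso.trans_hom, Iso.symm_hom, transpose_of_comp, mul_assoc, hK, h₁,
    whiskerLeftIso_hom, PrelaxFunctor.map₂Iso_hom, transpose_of_whiskerLeft, ← hI]
  rw [h₂, mul_mul_eq (evCur_slide f n), whiskerLeft_mul _ _ _ (by simp)
    (by simp [transpose, evCur]), mul_assoc]

/-- The unitor case, in which refolding is `t`. The strict unit equation is a variable `e` so that
it can be eliminated by substitution. -/
theorem transpose_slide_triT {a b x x' : V} (f : x ⟶ x') {n : x' ⊠ a ⟶ b} (e : x = ho a b)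
    {g : x' ⟶ ho a b} (I : g ≅ coev a x' ≫ hoMap a n)
    (Θ : rMap f a ≫ n ≅ rMap (eqToHom e) a ≫ ev a b) {w : Cell V}
    (hI : transpose a b (of I.hom) * evCur a x' n = w) :
    transpose a b (of (whiskerLeftIso f I ≪≫ slide f n ≪≫
      whiskerLeftIso (coev a x) (hoMap₂ a Θ) ≪≫ (slide (eqToHom e) (ev a b)).symm ≪≫
      whiskerLeftIso (eqToHom e) (triT a b) ≪≫ ρ_ _).hom) =
      (R a (one f) ⊚ w) * of Θ.hom := by
  subst e
  have hs : R a (idC (ho a b)) ⊚ evC a b = evC a b := by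
    rw [R_idC, idC_hcomp _ rfl]
  -- Here `z` is the identity cell of `ε`: the transpose of `t` is already the whole of `evCur`, so
  -- nothing has to be appended.
  rw [← transpose_slide_conj f _ I Θ (whiskerLeftIso _ (triT a b) ≪≫ ρ_ _) (z := evC a b) hI]
  · rw [transpose, mul_tgt_eq]
    rw [tgt_hcomp, tgt_R, tgt_of, eqToHom_refl, one_id, tgt_evC, hs]
  · rw [Iso.trans_hom, Strict.rightUnitor_eqToIso, eqToIso.hom, of_comp_eqToHom,
      whiskerLeftIso_hom, transpose_of_whiskerLeft, transpose_triT, mul_tgt_eq]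
    simp [evCur]

/-! ### Transposes of the associator and the unitors -/

/-- The cell of the associator. -/
def assocC (a b c d : V) : Cell V := of (selfAssociator a b c d).hom

/-- The cell of the left unitor. -/
def leftC (a b : V) : Cell V := of (selfLeftUnitor a b).hom

/-- The cell of the right unitor. -/
def rightC (a b : V) : Cell V := of (selfRightUnitor a b).hom

@[simp] theorem of_selfAssociator_hom (a b c d : V) :
    of (selfAssociator a b c d).hom = assocC a b c d := (rfl)

@[simp] theorem of_selfLeftUnitor_hom (a b : V) : of (selfLeftUnitor a b).hom = leftC a b := (rfl)

@[simp] theorem of_selfRightUnitor_hom (a b : V) :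
    of (selfRightUnitor a b).hom = rightC a b := (rfl)

@[simp] theorem src_assocC (a b c d : V) :
    src (assocC a b c d) = R (ho a b) (compC b c d) ⊚ compC a b d := by
  change one _ = _; simp

@[simp] theorem tgt_assocC (a b c d : V) :
    tgt (assocC a b c d) = L (ho c d) (compC a b c) ⊚ compC a c d := by
  change one _ = _; simp

@[simp] theorem dom_assocC (a b c d : V) :
    dom (assocC a b c d) = idC (ho c d ⊠ ho b c ⊠ ho a b) := by
  change idC ((ho c d ⊠ ho b c) ⊠ ho a b) = _
  rw [tensor_assoc]

@[simp] theorem cod_assocC (a b c d : V) : cod (assocC a b c d) = idC (ho a d) := (rfl)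

@[simp] theorem src_leftC (a b : V) : src (leftC a b) = R (ho a b) (unitC b) ⊚ compC a b b := by
  change one _ = _; simp

@[simp] theorem tgt_leftC (a b : V) : tgt (leftC a b) = idC (ho a b) := by
  change one _ = _; simp

@[simp] theorem cod_leftC (a b : V) : cod (leftC a b) = idC (ho a b) := (rfl)

@[simp] theorem src_rightC (a b : V) : src (rightC a b) = L (ho a b) (unitC a) ⊚ compC a a b := by
  change one _ = _; simp

@[simp] theorem tgt_rightC (a b : V) : tgt (rightC a b) = idC (ho a b) := by
  change one _ = _; simp

@[simp] theorem cod_rightC (a b : V) : cod (rightC a b) = idC (ho a b) := (rfl)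

/-- The associator joins two evaluations with the common target `ε ∘ 1ε ∘ 11ε`. Appending the
evaluation of its target 1-cell cancels the half that is followed backwards, leaving an equation
with no inverse of `e_m`. -/
theorem transpose_selfAssociator (a b c d : V) :
    transpose a d (assocC a b c d) *
      ((L (ho c d) (R a (compC a b c)) ⊚ evCompC a c d) *
        (L (ho c d) (evCompC a b c) ⊚ evC c d)) =
    (R (ho a b ⊠ a) (compC b c d) ⊚ evCompC a b d) *
      ((ich (selfComp b c d) (ev a b) ⊚ evC b d) *
        (L (ho c d ⊠ ho b c) (evC a b) ⊚ evCompC b c d)) := by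
  have hI := transpose_inv_mul _ (transpose_selfCompIso a c d) (by simp [evCur])
  have hK : transpose a d (of (whiskerLeftIso (asc (ho c d) (ho b c) (ho a b) ≫
      lMap (ho c d) (selfComp a b c)) (selfCompIso a c d).symm ≪≫ α_ _ _ _).hom) *
        (L (ho c d) (R a (compC a b c)) ⊚ evCompC a c d) =
      R a (one (asc (ho c d) (ho b c) (ho a b) ≫ lMap (ho c d) (selfComp a b c))) ⊚
        evCur a (ho c d ⊠ ho a c)
          ((asc (ho c d) (ho a c) a ≫ lMap (ho c d) (ev a c)) ≫ ev c d) := by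
    rw [← hI, whiskerLeft_mul _ _ _ (by simp) (by simp [transpose]), Iso.trans_hom,
      Strict.associator_eqToIso, eqToIso.hom, of_comp_eqToHom, whiskerLeftIso_hom,
      transpose_of_whiskerLeft]
    simp
  rw [← mul_assoc, ← of_selfAssociator_hom, selfAssociator,
    transpose_slide_conj _ _ _ _ _ (transpose_selfCompIso a b d) hK]
  -- The inverse of `1 ⊗ e_m` inside the associator meets the appended `1 ⊗ e_m`.
  have hl : (L (ho c d) (of (evComp a b c).inv) ⊚ evC c d) *
      (L (ho c d) (evCompC a b c) ⊚ evC c d) = L (ho c d) (L (ho b c) (evC a b) ⊚ evC b c) ⊚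
        evC c d := by
    rw [← mul_whiskerRight _ _ _ (by simp) (by simp), ← Cell.L_mul _ _ _ (by simp), ← of_evComp_hom,
      ← of_comp, Iso.inv_hom_id]
    simp [of_id]
  simp [of_comp, of_whiskerLeft, of_whiskerRight, Strict.associator_eqToIso, mul_assoc]
  rw [hl, mul_tgt_eq (x := _ ⊚ evCompC b c d)]
  simp

theorem transpose_selfLeftUnitor (a b : V) :
    transpose a b (leftC a b) =
    (R (ho a b ⊠ a) (unitC b) ⊚ evCompC a b b) *
      ((ich (selfUnit b) (ev a b) ⊚ evC b b) * (evC a b ⊚ evUnitC b)) := by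
  rw [← of_selfLeftUnitor_hom, selfLeftUnitor,
    transpose_slide_triT _ _ _ _ (transpose_selfCompIso a b b)]
  simp [of_comp, of_whiskerLeft, of_whiskerRight, Strict.associator_eqToIso]

theorem transpose_selfRightUnitor (a b : V) :
    transpose a b (rightC a b) =
    (L (ho a b) (R a (unitC a)) ⊚ evCompC a a b) * (L (ho a b) (evUnitC a) ⊚ evC a b) := by
  rw [← of_selfRightUnitor_hom, selfRightUnitor,
    transpose_slide_triT _ _ _ _ (transpose_selfCompIso a a b)]
  simp [of_whiskerLeft, of_whiskerRight]

theorem cancellable_evCompC (a b c : V) : Cancellable (evCompC a b c) := cancellable_hom _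

/-! ### The coherence equations on transposes -/

/-- On the left, `1λ` moves past `e_m` so that the transposes of `λ` and `α` apply. On the right,
`ρ1` moves past `e_m`, and naturality of the interchanger moves `ρ` past `ε`, where its own
transpose applies. Both sides become the same pasting of `e_m`, `e_u` and inverse interchangers. -/
theorem transpose_unitPastingLeft (c d e : V) :
    (L (ho d e) (R (ho c d ⊠ c) (unitC d)) ⊚ R c (assocC c d d e) ⊚ evC c e) *
      ((L (ho d e) (R c (leftC c d)) ⊚ R c (compC c d e) ⊚ evC c e) * evCompC c d e) =
    (R (ho c d ⊠ c) (rightC d e) ⊚ R c (compC c d e) ⊚ evC c e) * evCompC c d e := by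
  have h₁ := exchange (L (ho d e) (R c (leftC c d))) (evCompC c d e)
  have hA := congrArg (L (ho d e) (R (ho c d ⊠ c) (unitC d)) ⊚ ·) (transpose_selfAssociator c d d e)
  have hL := congrArg (L (ho d e) · ⊚ evC d e) (transpose_selfLeftUnitor c d)
  have h₂ := exchange (ich (lMap (ho d e) (selfUnit d)) (ev c d)) (evCompC d d e)
  have h₃ := exchange (R (ho c d ⊠ c) (rightC d e)) (evCompC c d e)
  have h₄ := congrArg (· ⊚ evC d e) (ich_naturality_left (selfRightUnitor d e).hom (ev c d))
  have hR := congrArg (L (ho d e) (evC c d) ⊚ ·) (transpose_selfRightUnitor d e)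
  -- Distributing whiskering over long composites produces nested boundary conditions, hence the
  -- discharge depth.
  simp (maxDischargeDepth := 8) [transpose, whiskerLeft_mul, mul_whiskerRight, Cell.L_mul]
    at h₁ hA hL h₂ h₃ hR
  simp (maxDischargeDepth := 8) [mul_whiskerRight, ich_eqToHom, ich_comp_left] at h₄
  rw [mul_tgt_eq (by simp), mul_assoc] at h₄
  rw [h₁, hL, mul_mul_mul_eq hA, h₃, h₄, hR, mul_assoc, mul_assoc, mul_mul_eq h₂.symm, mul_assoc]

/-- Three copies of `e_m` are appended, evaluating the target `m ∘ 1m ∘ 11m` completely, so that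
every associator meets the cells its transpose formula needs. The left side uses naturality of the
interchanger at `α` in the first variable, the right side at `e_m` in the second. Multiplicativity
then splits the interchangers into pieces that agree because `Σ` for `m ⊗ 1` and `ε` is `Σ` for `m`
and `1 ⊗ ε`. -/
theorem transpose_assocPasting (a b c d e : V) :
    (R (ho a b ⊠ a) (assocC b c d e) ⊚ R a (compC a b e) ⊚ evC a e) *
      ((L (ho d e) (R (ho a b ⊠ a) (compC b c d)) ⊚ R a (assocC a b d e) ⊚ evC a e) *
        ((L (ho d e) (R a (assocC a b c d)) ⊚ R a (compC a d e) ⊚ evC a e) *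
          ((L (ho d e ⊠ ho c d) (R a (compC a b c)) ⊚ L (ho d e) (R a (compC a c d)) ⊚
              evCompC a d e) *
            ((L (ho d e ⊠ ho c d) (R a (compC a b c)) ⊚ L (ho d e) (evCompC a c d) ⊚ evC d e) *
              (L (ho d e ⊠ ho c d) (evCompC a b c) ⊚ L (ho d e) (evC c d) ⊚ evC d e))))) =
    (R (ho b c ⊠ ho a b ⊠ a) (compC c d e) ⊚ R a (assocC a b c e) ⊚ evC a e) *
      ((ich (selfComp c d e) (rMap (selfComp a b c) a) ⊚ R a (compC a c e) ⊚ evC a e) *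
        ((L (ho d e ⊠ ho c d) (R a (compC a b c)) ⊚ R a (assocC a c d e) ⊚ evC a e) *
          ((L (ho d e ⊠ ho c d) (R a (compC a b c)) ⊚ L (ho d e) (R a (compC a c d)) ⊚
              evCompC a d e) *
            ((L (ho d e ⊠ ho c d) (R a (compC a b c)) ⊚ L (ho d e) (evCompC a c d) ⊚ evC d e) *
              (L (ho d e ⊠ ho c d) (evCompC a b c) ⊚ L (ho d e) (evC c d) ⊚ evC d e))))) := by
  have e₁ := exchange (L (ho d e) (R a (assocC a b c d))) (evCompC a d e)
  have A₁ := congrArg (L (ho d e) · ⊚ evC d e) (transpose_selfAssociator a b c d)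
  have A₂ := congrArg (L (ho d e) (R (ho a b ⊠ a) (compC b c d)) ⊚ ·)
    (transpose_selfAssociator a b d e)
  have e₂ := (exchange (ich (lMap (ho d e) (selfComp b c d)) (ev a b)) (evCompC b d e)).symm
  have e₃ := exchange (R (ho a b ⊠ a) (assocC b c d e)) (evCompC a b e)
  have N₁ := congrArg (· ⊚ evC b e)
    (ich_naturality_left (selfAssociator b c d e).hom (ev a b))
  have A₃ := congrArg (L (ho d e ⊠ ho c d ⊠ ho b c) (evC a b) ⊚ ·)
    (transpose_selfAssociator b c d e)
  have B₁ := congrArg (L (ho d e ⊠ ho c d) (R a (compC a b c)) ⊚ ·)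
    (transpose_selfAssociator a c d e)
  have f₁ := (exchange (L (ho d e ⊠ ho c d) (evCompC a b c)) (evCompC c d e)).symm
  have f₂ := exchange (ich (selfComp c d e) (rMap (selfComp a b c) a)) (evCompC a c e)
  have N₂ := congrArg (· ⊚ evC c e)
    (ich_naturality_right (selfComp c d e) (evComp a b c).hom)
  have B₂ := congrArg (R (ho b c ⊠ ho a b ⊠ a) (compC c d e) ⊚ ·)
    (transpose_selfAssociator a b c e)
  have f₃ := exchange (ich (selfComp c d e) (lMap (ho b c) (ev a b))) (evCompC b c e)
  simp at e₁ e₂ e₃ f₁ f₂ f₃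
  simp (maxDischargeDepth := 8) [transpose, mul_whiskerRight, Cell.L_mul] at A₁
  simp (maxDischargeDepth := 8) [transpose, whiskerLeft_mul] at A₂
  simp (maxDischargeDepth := 8) [transpose, whiskerLeft_mul] at A₃
  simp (maxDischargeDepth := 8) [transpose, whiskerLeft_mul] at B₁
  simp (maxDischargeDepth := 8) [transpose, whiskerLeft_mul] at B₂
  rw [ich_eqToHom_comp] at N₁
  rw [ich_comp_eqToHom] at N₂
  simp (maxDischargeDepth := 8) [mul_whiskerRight, ich_comp_left, ich_rMap, mul_assoc] at N₁
  simp (maxDischargeDepth := 8) [mul_whiskerRight, ich_comp_right, mul_assoc] at N₂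
  -- Left-hand side: the transposes of `1α`, of the middle `α` and of `α1` are expanded in this
  -- order, with exchanges making room.
  rw [mul_mul_eq e₁, mul_assoc, A₁, mul_mul_mul_eq A₂]
  simp only [mul_assoc]
  rw [mul_mul_eq e₂]
  simp only [mul_assoc]
  rw [mul_mul_eq e₃]
  simp only [mul_assoc]
  rw [mul_mul_mul_eq N₁]
  simp only [mul_assoc]
  -- After `A₃` the left side is free of associators; from `B₁` on, the right side is reduced to it.
  rw [A₃, mul_mul_mul_eq B₁]
  simp only [mul_assoc]
  rw [f₁, mul_mul_eq f₂]
  simp only [mul_assoc]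
  rw [mul_mul_mul_eq N₂.symm]
  simp only [mul_assoc]
  rw [mul_mul_mul_eq B₂]
  simp only [mul_assoc]
  rw [mul_mul_eq f₃.symm]
  simp only [mul_assoc]

end RightClosed

/-! ### The coherence pastings as boundary-free cells -/

namespace EnrichedBicategoryData

open Cell

variable {V : Type u} [Bicategory.{w, v} V] [GrayMonoid V] {O : Type u₁}
  (B : EnrichedBicategoryData V O)

attribute [local simp] tensor_assoc unit_tensor tensor_unit

theorem of_unitPastingLeft (c d e : O) :
    of (B.unitPastingLeft c d e) =
      (L (B.hom d e) (R (B.hom c d) (one (B.unit d))) ⊚ of (B.associator c d d e).hom) *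
        (L (B.hom d e) (of (B.leftUnitor c d).hom) ⊚ one (B.comp c d e)) := by
  simp [unitPastingLeft, of_comp, of_whiskerLeft, of_whiskerRight]

theorem of_unitPastingRight (c d e : O) :
    of (B.unitPastingRight c d e) =
      R (B.hom c d) (of (B.rightUnitor d e).hom) ⊚ one (B.comp c d e) := by
  simp [unitPastingRight, of_whiskerRight]

theorem of_assocPastingLeft (a b c d e : O) :
    of (B.assocPastingLeft a b c d e) =
      (R (B.hom a b) (of (B.associator b c d e).hom) ⊚ one (B.comp a b e)) *
        ((L (B.hom d e) (R (B.hom a b) (one (B.comp b c d))) ⊚ of (B.associator a b d e).hom) *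
          (L (B.hom d e) (of (B.associator a b c d).hom) ⊚ one (B.comp a d e))) := by
  simp [assocPastingLeft, of_comp, of_whiskerLeft, of_whiskerRight, Strict.associator_eqToIso]

theorem of_assocPastingRight (a b c d e : O) :
    of (B.assocPastingRight a b c d e) =
      (R (B.hom b c ⊠ B.hom a b) (one (B.comp c d e)) ⊚ of (B.associator a b c e).hom) *
        ((ich (B.comp c d e) (B.comp a b c) ⊚ one (B.comp a c e)) *
          (L (B.hom d e ⊠ B.hom c d) (one (B.comp a b c)) ⊚ of (B.associator a c d e).hom)) := by
  simp [assocPastingRight, of_comp, of_whiskerLeft, of_whiskerRight, Strict.associator_eqToIso]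

end EnrichedBicategoryData

/-! ### Cancellation of evaluations and conclusion -/

namespace RightClosed

open Cell

variable {V : Type u} [Bicategory.{w, v} V] [GrayMonoid V] [RightClosed V]

attribute [local simp] tensor_assoc unit_tensor tensor_unit

theorem transpose_identity_coherence (c d e : V) :
    transpose c e ((L (ho d e) (R (ho c d) (unitC d)) ⊚ assocC c d d e) *
        (L (ho d e) (leftC c d) ⊚ compC c d e)) =
      transpose c e (R (ho c d) (rightC d e) ⊚ compC c d e) := by
  have h := transpose_unitPastingLeft c d e
  refine (cancellable_evCompC c d e).mul_right_cancel ?_ ?_ ?_ <;>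
    simp (maxDischargeDepth := 8) [transpose, Cell.R_mul, mul_whiskerRight, mul_assoc] at h ⊢
  exact h

/-- The three evaluations appended in `transpose_assocPasting` are whiskered copies of the
invertible `e_m`, so they can be cancelled one at a time from the right. -/
theorem transpose_associativity_coherence (a b c d e : V) :
    transpose a e ((R (ho a b) (assocC b c d e) ⊚ compC a b e) *
        ((L (ho d e) (R (ho a b) (compC b c d)) ⊚ assocC a b d e) *
          (L (ho d e) (assocC a b c d) ⊚ compC a d e))) =
      transpose a e ((R (ho b c ⊠ ho a b) (compC c d e) ⊚ assocC a b c e) *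
        ((ich (selfComp c d e) (selfComp a b c) ⊚ compC a c e) *
          (L (ho d e ⊠ ho c d) (compC a b c) ⊚ assocC a c d e))) := by
  have h₁ := (cancellable_evCompC a d e).whiskerLeft
    (L (ho d e ⊠ ho c d) (R a (compC a b c)) ⊚ L (ho d e) (R a (compC a c d))) (by simp)
  have h₂ := (((cancellable_evCompC a c d).L (ho d e)).whiskerRight (evC d e)
    (by simp)).whiskerLeft (L (ho d e ⊠ ho c d) (R a (compC a b c))) (by simp)
  have h₃ := ((cancellable_evCompC a b c).L (ho d e ⊠ ho c d)).whiskerRight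
    (L (ho d e) (evC c d) ⊚ evC d e) (by simp)
  have h := transpose_assocPasting a b c d e
  simp only [hcomp_assoc] at h₁ h₂ h₃
  refine h₁.mul_right_cancel ?_ ?_ (h₂.mul_right_cancel ?_ ?_ (h₃.mul_right_cancel ?_ ?_ ?_)) <;>
    simp (maxDischargeDepth := 8) [transpose, Cell.R_mul, mul_whiskerRight, mul_assoc, R_ich]
      at h ⊢
  exact h

theorem selfEnrichment_identity_coherence (c d e : V) :
    (selfEnrichmentData V).unitPastingLeft c d e ≫
        eqToHom (by simp [rMap_eqToHom, lMap_eqToHom]) =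
      (selfEnrichmentData V).unitPastingRight c d e :=
  eq_of_transpose (a := c) (y := e)
    -- The comparison of the two forms of the strict unit constraint is an `eqToHom` and vanishes
    -- among cells.
    ((congrArg (transpose c e) ((of_comp_eqToHom _ _).trans
      ((selfEnrichmentData V).of_unitPastingLeft c d e))).trans
      ((transpose_identity_coherence c d e).trans
        (congrArg (transpose c e) ((selfEnrichmentData V).of_unitPastingRight c d e)).symm))

theorem selfEnrichment_associativity_coherence (a b c d e : V) :
    (selfEnrichmentData V).assocPastingLeft a b c d e =
      (selfEnrichmentData V).assocPastingRight a b c d e :=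
  eq_of_transpose (a := a) (y := e)
    ((congrArg (transpose a e) ((selfEnrichmentData V).of_assocPastingLeft a b c d e)).trans
      ((transpose_associativity_coherence a b c d e).trans
        (congrArg (transpose a e) ((selfEnrichmentData V).of_assocPastingRight a b c d e)).symm))

end RightClosed

theorem mainTheorem3 {V : Type u} [Bicategory.{w, v} V] [GrayMonoid V] [RightClosed V] :
    ∃ E : EnrichedBicategory V V,
      E.toEnrichedBicategoryData = RightClosed.selfEnrichmentData V :=
  ⟨{ RightClosed.selfEnrichmentData V with
      identity_coherence := RightClosed.selfEnrichment_identity_coherence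
      associativity_coherence := RightClosed.selfEnrichment_associativity_coherence }, rfl⟩
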